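/- Let $\mathcal A$ and $\mathcal B$ be abelian categories and $\mathbf F:\mathcal A\to\mathcal B$ an additive, right exact functor. Let $(\mathbf F,\mathcal B)$ be the left comma category: its objects are triples $\binom{Y}{X}_\phi$ with $Y\in\mathcal A$, $X\in\mathcal B$ and $\phi:\mathbf FY\to X$, and its morphisms are the pairs $(\alpha,\beta)$ with $\beta\phi=\phi'\,\mathbf F\alpha$; it is abelian. For an abelian category $\mathcal C$, a complete projective resolution is an exact complex $\cdots\to Q^{-1}\to Q^{0}\to Q^{1}\to\cdots$ of projective objects which remains exact under $\operatorname{Hom}(-,P)$ for every projective $P$. An object is Gorenstein projective if it is isomorphic to $\operatorname{Im}(Q^{-1}\to Q^{0})$ for such a complex; $\mathcal{GP}(\mathcal C)$ is the full subcategory of these objects, and $\underline{\mathcal{GP}(\mathcal C)}$ is its quotient by the morphisms that factor through a projective object of $\mathcal C$. The category $\underline{\mathcal{GP}(\mathcal C)}$ is triangulated as the stable category of the Frobenius category $\mathcal{GP}(\mathcal C)$: the shift $X[1]$ is given by the cokernel $\Sigma X$ in a short exact sequence $0\to X\to P(X)\to \Sigma X\to 0$ with $P(X)$ projective and $\Sigma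 X$ Gorenstein projective, and the distinguished triangles are those isomorphic to $X\xrightarrow{u}Y\to C_u\to \Sigma X$, where $C_u$ is the pushout of $u$ and $X\to P(X)$, and $C_u\to\Sigma X$ is induced by $0:Y\to\Sigma X$ and $P(X)\to\Sigma X$. Assume that $\mathbf F$ is perfect, that is: (P1) if $Q^\bullet$ is an exact complex (indexed by $\mathbb Z$) of projective objects of $\mathcal A$, then $\mathbf FQ^\bullet$ is exact; (P2) if $P^\bullet$ is a complete projective resolution in $\mathcal B$, then $\operatorname{Hom}(P^\bullet,\mathbf FQ)$ is exact for every projective object $Q$ of $\mathcal A$. Then the functors $$\textstyle \binom{Y}{X}_\phi\mapsto\operatorname{Coker}\phi,\qquad X\mapsto\binom{0}{X},\qquad Y\mapsto\binom{Y}{\mathbf FY}_{\mathrm{id}},\qquad \binom{Y}{X}_\phi\mapsto Y$$ preserve Gorenstein projective objects and projective objects, and the functors $$i^*:\underline{\mathcal{GP}((\mathbf F,\mathcal B))}\to\underline{\mathcal{GP}(\mathcal B)},\quad i_*:\underline{\mathcal{GP}(\mathcal B)}\to\underline{\mathcal{GP}((\mathbf F,\mathcal B))},\quad j_!:\underline{\mathcal{GP}(\mathcal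 A)}\to\underline{\mathcal{GP}((\mathbf F,\mathcal B))},\quad j^*:\underline{\mathcal{GP}((\mathbf F,\mathcal B))}\to\underline{\mathcal{GP}(\mathcal A)}$$ that they induce (in this order) form a left recollement of $\underline{\mathcal{GP}((\mathbf F,\mathcal B))}$ relative to $\underline{\mathcal{GP}(\mathcal B)}$ and $\underline{\mathcal{GP}(\mathcal A)}$: all four are exact functors of triangulated categories; $(i^*,i_*)$ and $(j_!,j^*)$ are adjoint pairs; $i_*$ and $j_!$ are fully faithful; $j^*i_*=0$; and for every object $M$ of $\underline{\mathcal{GP}((\mathbf F,\mathcal B))}$ the counit and the unit of these adjunctions fit into a distinguished triangle $$j_!j^*M\to M\to i_*i^*M\to (j_!j^*M)[1].$$ -/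

import Mathlib

open CategoryTheory CategoryTheory.Limits CategoryTheory.Pretriangulated
open scoped ZeroObject

universe v v₁ v₂ v₃ u u₁ u₂ u₃

noncomputable section

namespace GorensteinComma

/-! ### Gorenstein projective objects -/

section Gorenstein

variable {C : Type u} [Category.{v} C] [Abelian C]

/-- The complex of abelian groups `Hom(K, Z)` is exact: every `f : Kʲ ⟶ Z` whose composite with
`Kʲ⁻¹ ⟶ Kʲ` vanishes is the composite of `Kʲ ⟶ Kʲ⁺¹` and some `g : Kʲ⁺¹ ⟶ Z`. -/
def HomExact (K : CochainComplex C ℤ) (Z : C) : Prop :=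
  ∀ (i j k : ℤ), i + 1 = j → j + 1 = k → ∀ f : K.X j ⟶ Z, K.d i j ≫ f = 0 →
    ∃ g : K.X k ⟶ Z, K.d j k ≫ g = f

/-- Complete projective resolutions: exact complexes of projective objects, indexed by `ℤ`,
that remain exact under `Hom(-, P)` for every projective object `P`. -/
structure IsCompleteResolution (K : CochainComplex C ℤ) : Prop where
  projective : ∀ n, Projective (K.X n)
  acyclic : K.Acyclic
  homExact : ∀ P : C, Projective P → HomExact K P

variable (C) in
/-- Gorenstein projective objects: the images of the differential `K⁻¹ ⟶ K⁰` of complete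
projective resolutions `K`. -/
def GProj : ObjectProperty C := fun G =>
  ∃ K : CochainComplex C ℤ, IsCompleteResolution K ∧ Nonempty (G ≅ image (K.d (-1) 0))

variable (C) in
/-- The full subcategory of Gorenstein projective objects. -/
abbrev GP : Type _ := (GProj C).FullSubcategory

variable (C) in
/-- Two morphisms are identified in the stable category when their difference factors through a
projective object. -/
def stableRel : HomRel (GP C) := fun X Y f g =>
  ∃ (P : C) (a : X.obj ⟶ P) (b : P ⟶ Y.obj), Projective P ∧ f.hom - g.hom = a ≫ b

instance : Congruence (stableRel C) where
  comp_left := by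
    rintro X Y Z f g g' ⟨P, a, b, hP, h⟩
    exact ⟨P, f.hom ≫ a, b, hP, by simp [← Preadditive.comp_sub, h]⟩
  comp_right := by
    rintro X Y Z f f' g ⟨P, a, b, hP, h⟩
    exact ⟨P, a, b ≫ g.hom, hP, by simp [← Preadditive.sub_comp, h]⟩
  equivalence := by
    refine ⟨fun f => ?_, ?_, ?_⟩
    · exact ⟨0, 0, 0, inferInstance, by simp⟩
    · rintro f g ⟨P, a, b, hP, h⟩
      exact ⟨P, -a, b, hP, by simp [← h]⟩
    · rintro f g k ⟨P, a, b, hP, h⟩ ⟨P', a', b', hP', h'⟩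
      refine ⟨P ⊞ P', biprod.lift a a', biprod.desc b b', inferInstance, ?_⟩
      simp [← h, ← h']

lemma stableRel_add ⦃X Y : GP C⦄ (f₁ f₂ g₁ g₂ : X ⟶ Y) (hf : stableRel C f₁ f₂)
    (hg : stableRel C g₁ g₂) : stableRel C (f₁ + g₁) (f₂ + g₂) := by
  obtain ⟨P, a, b, hP, h⟩ := hf
  obtain ⟨P', a', b', hP', h'⟩ := hg
  refine ⟨P ⊞ P', biprod.lift a a', biprod.desc b b', inferInstance, ?_⟩
  simp only [biprod.lift_desc, ← h, ← h']
  change (f₁.hom + g₁.hom) - (f₂.hom + g₂.hom) = _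
  abel

variable (C) in
/-- The stable category of Gorenstein projective objects modulo projective objects. -/
abbrev StableGP : Type _ := CategoryTheory.Quotient (stableRel C)

variable (C) in
/-- The projection to the stable category. -/
abbrev toStable : GP C ⥤ StableGP C := CategoryTheory.Quotient.functor (stableRel C)

instance : Preadditive (StableGP C) := CategoryTheory.Quotient.preadditive _ stableRel_add

instance : (toStable C).Additive := CategoryTheory.Quotient.functor_additive _ stableRel_add

lemma gproj_zero : GProj C (0 : C) := by
  refine ⟨0, ⟨fun n => ?_, fun n => ?_, fun P _ i n k _ _ f _ => ⟨0, ?_⟩⟩, ⟨?_⟩⟩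
  · have : IsZero ((0 : CochainComplex C ℤ).X n) :=
      (HomologicalComplex.eval C (ComplexShape.up ℤ) n).map_isZero (isZero_zero _)
    exact Projective.of_iso this.isoZero.symm inferInstance
  · exact ShortComplex.exact_of_isZero_X₂ _
      ((HomologicalComplex.eval C (ComplexShape.up ℤ) n).map_isZero (isZero_zero _))
  · exact IsZero.eq_of_src
      ((HomologicalComplex.eval C (ComplexShape.up ℤ) n).map_isZero (isZero_zero _)) _ _
  · refine (IsZero.iso (isZero_zero C) ?_)
    rw [IsZero.iff_id_eq_zero, ← cancel_epi (factorThruImage _)]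
    exact IsZero.eq_of_src
      ((HomologicalComplex.eval C (ComplexShape.up ℤ) (-1)).map_isZero (isZero_zero _)) _ _

instance : HasZeroObject (StableGP C) where
  zero := by
    refine ⟨(toStable C).obj ⟨0, gproj_zero⟩, ?_⟩
    have : IsZero (⟨0, gproj_zero⟩ : GP C) := by
      rw [IsZero.iff_id_eq_zero]
      ext
    exact (toStable C).map_isZero this

/-! ### The suspension and the standard triangles -/

/-- A short exact sequence `0 ⟶ G ⟶ P ⟶ G' ⟶ 0` with `P` projective and `G'` Gorenstein
projective, such that every morphism from `G` to a projective object extends to `P` (so that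
`G ⟶ P` is an inflation into a projective-injective object of the Frobenius category of Gorenstein
projective objects). -/
structure Cosyzygy (G : GP C) where
  P : C
  obj : GP C
  ι : G.obj ⟶ P
  π : P ⟶ obj.obj
  zero : ι ≫ π = 0
  shortExact : (ShortComplex.mk ι π zero).ShortExact
  projective : Projective P
  extend : ∀ (Q : C), Projective Q → ∀ f : G.obj ⟶ Q, ∃ g : P ⟶ Q, ι ≫ g = f

lemma shortExact_image (S : ShortComplex C) (hS : S.Exact) :
    ∃ h : image.ι S.f ≫ factorThruImage S.g = 0,
      (ShortComplex.mk (image.ι S.f) (factorThruImage S.g) h).ShortExact := by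
  have h : image.ι S.f ≫ factorThruImage S.g = 0 := by
    rw [← cancel_epi (factorThruImage S.f), ← cancel_mono (image.ι S.g)]
    simp
  refine ⟨h, ?_⟩
  have : Mono (ShortComplex.mk (image.ι S.f) (factorThruImage S.g) h).f :=
    inferInstanceAs (Mono (image.ι S.f))
  have : Epi (ShortComplex.mk (image.ι S.f) (factorThruImage S.g) h).g :=
    inferInstanceAs (Epi (factorThruImage S.g))
  let φ : S ⟶ ShortComplex.mk (image.ι S.f) S.g (by
      rw [← cancel_epi (factorThruImage S.f)]; simp) :=
    { τ₁ := factorThruImage S.f, τ₂ := 𝟙 _, τ₃ := 𝟙 _ }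
  let ψ : ShortComplex.mk (image.ι S.f) (factorThruImage S.g) h ⟶
      ShortComplex.mk (image.ι S.f) S.g (by
      rw [← cancel_epi (factorThruImage S.f)]; simp) :=
    { τ₁ := 𝟙 _, τ₂ := 𝟙 _, τ₃ := image.ι S.g }
  have hφ₁ : Epi φ.τ₁ := inferInstanceAs (Epi (factorThruImage S.f))
  have hφ₂ : IsIso φ.τ₂ := inferInstanceAs (IsIso (𝟙 _))
  have hφ₃ : Mono φ.τ₃ := inferInstanceAs (Mono (𝟙 _))
  have hψ₁ : Epi ψ.τ₁ := inferInstanceAs (Epi (𝟙 _))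
  have hψ₂ : IsIso ψ.τ₂ := inferInstanceAs (IsIso (𝟙 _))
  have hψ₃ : Mono ψ.τ₃ := inferInstanceAs (Mono (image.ι S.g))
  refine ShortComplex.ShortExact.mk ?_
  rw [ShortComplex.exact_iff_of_epi_of_isIso_of_mono ψ,
    ← ShortComplex.exact_iff_of_epi_of_isIso_of_mono φ]
  exact hS

lemma shift_isCompleteResolution {K : CochainComplex C ℤ} (hK : IsCompleteResolution K) :
    IsCompleteResolution (K⟦(1 : ℤ)⟧) where
  projective n := hK.projective (n + 1)
  acyclic n := ShortComplex.exact_of_iso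
    ((CochainComplex.shiftShortComplexFunctorIso C 1 n (1 + n) rfl).symm.app K) (hK.acyclic _)
  homExact P hP i j k hij hjk f hf := by
    obtain ⟨g, hg⟩ := hK.homExact P hP (i + 1) (j + 1) (k + 1) (by lia) (by lia) f (by
      have h : (Int.negOnePow 1 • K.d (i + 1) (j + 1)) ≫ f = 0 := hf
      rw [Int.negOnePow_one, Units.neg_smul, one_smul] at h
      exact neg_eq_zero.1 ((Preadditive.neg_comp (K.d (i + 1) (j + 1)) _).symm.trans h))
    refine ⟨-g, ?_⟩
    change (Int.negOnePow 1 • K.d (j + 1) (k + 1)) ≫ (-g) = f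
    simpa using hg

lemma exists_cosyzygy (G : GP C) : Nonempty (Cosyzygy G) := by
  obtain ⟨K, hK, ⟨e⟩⟩ := G.property
  have hS : (K.sc' (-1) 0 1).Exact :=
    (K.exactAt_iff' (-1) 0 1 (by simp) (by simp)).1 (hK.acyclic 0)
  obtain ⟨h, hE⟩ := shortExact_image _ hS
  have hd : (K⟦(1 : ℤ)⟧).d (-1) 0 = -K.d 0 1 := by
    change Int.negOnePow 1 • K.d 0 1 = _
    simp
  have hG' : GProj C (image (K.d 0 1)) :=
    have : StrongEpi (factorThruImage (K.d 0 1)) := strongEpi_of_epi _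
    have e' : image (K.d 0 1) ≅ image (-K.d 0 1) :=
      image.isoStrongEpiMono (factorThruImage (K.d 0 1)) (-image.ι (K.d 0 1)) (by simp)
    ⟨_, shift_isCompleteResolution hK, 
      ⟨e' ≪≫ eqToIso (congrArg (fun f : K.X 0 ⟶ K.X 1 => image f) hd.symm)⟩⟩
  have hz : (e.hom ≫ image.ι (K.d (-1) 0)) ≫ factorThruImage (K.d 0 1) = 0 := by
    rw [Category.assoc]
    exact (congrArg (e.hom ≫ ·) h).trans comp_zero
  refine ⟨⟨K.X 0, ⟨_, hG'⟩, e.hom ≫ image.ι (K.d (-1) 0), factorThruImage (K.d 0 1), hz, ?_,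
    hK.projective 0, fun Q hQ f => ?_⟩⟩
  · let S₁ : ShortComplex C := ShortComplex.mk (image.ι (K.d (-1) 0)) (factorThruImage (K.d 0 1)) h
    let S₂ : ShortComplex C := ShortComplex.mk _ _ hz
    let i : S₁ ≅ S₂ := ShortComplex.isoMk e.symm (Iso.refl _) (Iso.refl _)
      (by simp [S₁, S₂]) (by simp [S₁, S₂])
    exact ShortComplex.shortExact_of_iso i hE
  · obtain ⟨g, hg⟩ := hK.homExact Q hQ (-2) (-1) 0 (by lia) (by lia)
      (factorThruImage (K.d (-1) 0) ≫ e.inv ≫ f) (by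
        have : K.d (-2) (-1) ≫ factorThruImage (K.d (-1) 0) = 0 := by
          rw [← cancel_mono (image.ι _)]
          simp
        rw [reassoc_of% this, zero_comp])
    refine ⟨g, ?_⟩
    have : image.ι (K.d (-1) 0) ≫ g = e.inv ≫ f := by
      rw [← cancel_epi (factorThruImage (K.d (-1) 0))]
      simpa using hg
    simp [this]

/-- A choice of a cosyzygy sequence `0 ⟶ G ⟶ P(G) ⟶ Σ G ⟶ 0`. -/
def cosyzygy (G : GP C) : Cosyzygy G := (exists_cosyzygy G).some

/-- `h : Σ X ⟶ Σ Y` is induced by `f : X ⟶ Y` if it is part of a morphism between the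
chosen cosyzygy sequences that starts with `f`. -/
def IsSuspensionOf {X Y : GP C} (f : X ⟶ Y) (h : (cosyzygy X).obj ⟶ (cosyzygy Y).obj) : Prop :=
  ∃ g : (cosyzygy X).P ⟶ (cosyzygy Y).P,
    (cosyzygy X).ι ≫ g = f.hom ≫ (cosyzygy Y).ι ∧ (cosyzygy X).π ≫ h.hom = g ≫ (cosyzygy Y).π

lemma exists_desc {X : GP C} {Z : C} (t : (cosyzygy X).P ⟶ Z) (ht : (cosyzygy X).ι ≫ t = 0) :
    ∃ s : (cosyzygy X).obj.obj ⟶ Z, (cosyzygy X).π ≫ s = t := by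
  have := (cosyzygy X).shortExact.epi_g
  exact ⟨(cosyzygy X).shortExact.exact.desc t ht, (cosyzygy X).shortExact.exact.g_desc t ht⟩

lemma exists_suspension {X Y : GP C} (f : X ⟶ Y) : ∃ h, IsSuspensionOf f h := by
  obtain ⟨g, hg⟩ := (cosyzygy X).extend _ (cosyzygy Y).projective (f.hom ≫ (cosyzygy Y).ι)
  obtain ⟨s, hs⟩ := exists_desc (g ≫ (cosyzygy Y).π) (by
    rw [← Category.assoc, hg, Category.assoc, (cosyzygy Y).zero, comp_zero])
  exact ⟨ObjectProperty.homMk s, g, hg, hs⟩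

lemma suspension_unique {X Y : GP C} {f f' : X ⟶ Y} {h h' : (cosyzygy X).obj ⟶ (cosyzygy Y).obj}
    (hf : stableRel C f f') (hh : IsSuspensionOf f h) (hh' : IsSuspensionOf f' h') :
    stableRel C h h' := by
  obtain ⟨g, hg, hg₂⟩ := hh
  obtain ⟨g', hg', hg₂'⟩ := hh'
  obtain ⟨Q, a, b, hQ, hab⟩ := hf
  obtain ⟨a', ha'⟩ := (cosyzygy X).extend Q hQ a
  obtain ⟨s, hs⟩ := exists_desc (g - g' - a' ≫ b ≫ (cosyzygy Y).ι) (by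
    rw [Preadditive.comp_sub, Preadditive.comp_sub, hg, hg', reassoc_of% ha',
      ← Preadditive.sub_comp, hab, Category.assoc, sub_self])
  refine ⟨_, s, (cosyzygy Y).π, (cosyzygy Y).projective, ?_⟩
  have := (cosyzygy X).shortExact.epi_g
  have h0 := (cosyzygy Y).zero
  change Epi (cosyzygy X).π at this
  rw [← cancel_epi (cosyzygy X).π, ← Category.assoc, hs, Preadditive.comp_sub, hg₂, hg₂']
  simp [h0]

variable (C) in
/-- The cosyzygy as a functor to the stable category. -/
def suspensionAux : GP C ⥤ StableGP C where
  obj X := (toStable C).obj (cosyzygy X).obj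
  map f := (toStable C).map (exists_suspension f).choose
  map_id X := by
    rw [← (toStable C).map_id]
    exact CategoryTheory.Quotient.sound _ (suspension_unique (Congruence.equivalence.refl (𝟙 X))
      (exists_suspension (𝟙 X)).choose_spec ⟨𝟙 _, by simp, by simp⟩)
  map_comp {X Y Z} f g := by
    rw [← (toStable C).map_comp]
    refine CategoryTheory.Quotient.sound _ (suspension_unique
      (Congruence.equivalence.refl (f ≫ g)) (exists_suspension (f ≫ g)).choose_spec ?_)
    obtain ⟨p, hp, hp'⟩ := (exists_suspension f).choose_spec
    obtain ⟨q, hq, hq'⟩ := (exists_suspension g).choose_spec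
    exact ⟨p ≫ q, by simp [reassoc_of% hp, hq], by simp [reassoc_of% hp', hq']⟩

variable (C) in
/-- The suspension functor `Σ` of the stable category: it sends `X` to the cokernel of the chosen
embedding `X ⟶ P(X)`, and the class of `f` to the class of any `h` induced by `f`. -/
def suspension : StableGP C ⥤ StableGP C :=
  CategoryTheory.Quotient.lift _ (suspensionAux C) (fun _ _ f g hfg =>
    CategoryTheory.Quotient.sound _ (suspension_unique hfg
      (exists_suspension f).choose_spec (exists_suspension g).choose_spec))

variable (C) in
/-- A standard triangle `X ⟶ Y ⟶ Z ⟶ Σ X`: the object `Z` is the pushout of `u : X ⟶ Y` and the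
chosen embedding `X ⟶ P(X)`, and `w : Z ⟶ Σ X` is induced by `0 : Y ⟶ Σ X` and `P(X) ⟶ Σ X`. -/
structure StandardTriangle where
  X : GP C
  Y : GP C
  Z : GP C
  u : X ⟶ Y
  v : Y ⟶ Z
  k : (cosyzygy X).P ⟶ Z.obj
  w : Z ⟶ (cosyzygy X).obj
  isPushout : IsPushout u.hom (cosyzygy X).ι v.hom k
  v_w : v ≫ w = 0
  k_w : k ≫ w.hom = (cosyzygy X).π

/-- The last morphism of a standard triangle, in the stable category. -/
def StandardTriangle.connecting (S : StandardTriangle C) :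
    (toStable C).obj S.Z ⟶ (suspension C).obj ((toStable C).obj S.X) :=
  (toStable C).map S.w

variable (C) in
/-- The triangulated structure of the stable category of the Frobenius category of Gorenstein
projective objects: a triangulated structure on the stable category in which the shift `[1]` is
the suspension `Σ` and in which the distinguished triangles are exactly the triangles isomorphic
to a standard triangle. This determines the triangulated structure up to a canonical isomorphism
that is the identity on the underlying category; the integral shifts `[n]`, `n ≠ 1`, are the only
data that are not prescribed on the nose. -/
class StableTriangulation where
  [shift : HasShift (StableGP C) ℤ]
  [shift_additive : ∀ n : ℤ, (shiftFunctor (StableGP C) n).Additive]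
  [pretriangulated : Pretriangulated (StableGP C)]
  [triangulated : IsTriangulated (StableGP C)]
  shiftIso : shiftFunctor (StableGP C) (1 : ℤ) ≅ suspension C
  distinguished_iff : ∀ T : Triangle (StableGP C), T ∈ distTriang (StableGP C) ↔
    ∃ S : StandardTriangle C, Nonempty (T ≅ Triangle.mk ((toStable C).map S.u)
      ((toStable C).map S.v) (S.connecting ≫ shiftIso.inv.app _))

attribute [reducible, instance] StableTriangulation.shift StableTriangulation.pretriangulated

attribute [instance] StableTriangulation.shift_additive StableTriangulation.triangulated

end Gorenstein

/-! ### Functors induced on stable categories -/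

section Induced

variable {C : Type u₁} [Category.{v₁} C] [Abelian C] {D : Type u₂} [Category.{v₂} D] [Abelian D]

/-- The functor `G` preserves Gorenstein projective objects and projective objects. -/
structure PreservesGP (G : C ⥤ D) : Prop where
  gproj : ∀ X : C, GProj C X → GProj D (G.obj X)
  projective : ∀ P : C, Projective P → Projective (G.obj P)

/-- The functor induced on stable categories by an additive functor which preserves Gorenstein
projective objects and projective objects. -/
def stableMap (G : C ⥤ D) [G.Additive] (hG : PreservesGP G) : StableGP C ⥤ StableGP D :=
  CategoryTheory.Quotient.lift _
    ((GProj D).lift ((GProj C).ι ⋙ G) (fun X => hG.gproj _ X.property) ⋙ toStable D) (by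
      rintro X Y f g ⟨P, a, b, hP, h⟩
      refine CategoryTheory.Quotient.sound _ ⟨G.obj P, G.map a, G.map b, hG.projective P hP, ?_⟩
      rw [← G.map_comp, ← h, G.map_sub]
      rfl)

end Induced

/-! ### Left recollements of triangulated categories -/

/-- Four functors `i^* : T ⥤ T'`, `i_* : T' ⥤ T`, `j_! : T'' ⥤ T`, `j^* : T ⥤ T''` between
triangulated categories form a left recollement of `T` relative to `T'` and `T''`. -/
structure LeftRecollement
    {T' : Type u₁} [Category.{v₁} T'] [HasZeroObject T'] [HasShift T' ℤ] [Preadditive T']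
    [∀ n : ℤ, (shiftFunctor T' n).Additive] [Pretriangulated T'] [IsTriangulated T']
    {T : Type u₂} [Category.{v₂} T] [HasZeroObject T] [HasShift T ℤ] [Preadditive T]
    [∀ n : ℤ, (shiftFunctor T n).Additive] [Pretriangulated T] [IsTriangulated T]
    {T'' : Type u₃} [Category.{v₃} T''] [HasZeroObject T''] [HasShift T'' ℤ] [Preadditive T'']
    [∀ n : ℤ, (shiftFunctor T'' n).Additive] [Pretriangulated T''] [IsTriangulated T'']
    (iUp : T ⥤ T') (iLow : T' ⥤ T) (jShriek : T'' ⥤ T) (jUp : T ⥤ T'') where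
  /-- the four functors are exact functors of triangulated categories -/
  [iUp_commShift : iUp.CommShift ℤ]
  [iUp_exact : iUp.IsTriangulated]
  [iLow_commShift : iLow.CommShift ℤ]
  [iLow_exact : iLow.IsTriangulated]
  [jShriek_commShift : jShriek.CommShift ℤ]
  [jShriek_exact : jShriek.IsTriangulated]
  [jUp_commShift : jUp.CommShift ℤ]
  [jUp_exact : jUp.IsTriangulated]
  /-- the adjoint pairs `(i^*, i_*)` and `(j_!, j^*)` -/
  adj_i : iUp ⊣ iLow
  adj_j : jShriek ⊣ jUp
  /-- `i_*` and `j_!` are fully faithful -/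
  iLow_full : iLow.Full
  iLow_faithful : iLow.Faithful
  jShriek_full : jShriek.Full
  jShriek_faithful : jShriek.Faithful
  /-- `j^* i_* = 0` -/
  comp_zero : ∀ X : T', IsZero (jUp.obj (iLow.obj X))
  /-- the counit and the unit fit into a distinguished triangle
  `j_! j^* X ⟶ X ⟶ i_* i^* X ⟶ (j_! j^* X)[1]` -/
  triangle : ∀ X : T, ∃ h : iLow.obj (iUp.obj X) ⟶ (jShriek.obj (jUp.obj X))⟦(1 : ℤ)⟧,
    Triangle.mk (adj_j.counit.app X) (adj_i.unit.app X) h ∈ distTriang T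

/-! ### The left comma category -/

section LeftComma

variable {A : Type u₁} [Category.{v₁} A] [Abelian A] {B : Type u₂} [Category.{v₂} B] [Abelian B]

/-- The left comma category `(F, B)`: objects are triples `(Y, X, φ : F Y ⟶ X)`. -/
abbrev LeftComma (F : A ⥤ B) : Type _ := Comma F (𝟭 B)

/-- The functor `F` is perfect: it sends exact complexes of projective objects to exact complexes,
and `Hom(P, F Q)` is exact for every complete projective resolution `P` in `B` and every projective
object `Q` of `A`. -/
structure IsPerfect (F : A ⥤ B) [F.Additive] : Prop where
  exact : ∀ Q : CochainComplex A ℤ, (∀ n, Projective (Q.X n)) → Q.Acyclic →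
    ((F.mapHomologicalComplex (ComplexShape.up ℤ)).obj Q).Acyclic
  homExact : ∀ P : CochainComplex B ℤ, IsCompleteResolution P →
    ∀ Q : A, Projective Q → HomExact P (F.obj Q)

variable (F : A ⥤ B) [F.Additive]

section

variable [PreservesFiniteColimits F]

instance (J : Type) [SmallCategory J] [FinCategory J] :
    PreservesLimitsOfShape J (Comma.fst F (𝟭 B)) where
  preservesLimit :=
    preservesLimit_of_preserves_limit_cone
      (Comma.coneOfPreservesIsLimit _ (limit.isLimit _) (limit.isLimit _)) (limit.isLimit _)

instance (J : Type) [SmallCategory J] [FinCategory J] :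
    PreservesLimitsOfShape J (Comma.snd F (𝟭 B)) where
  preservesLimit :=
    preservesLimit_of_preserves_limit_cone
      (Comma.coneOfPreservesIsLimit _ (limit.isLimit _) (limit.isLimit _)) (limit.isLimit _)

instance (X Y : LeftComma F) (f : X ⟶ Y) : IsIso (Abelian.coimageImageComparison f) := by
  have h₁ : IsIso ((Comma.fst F (𝟭 B)).map (Abelian.coimageImageComparison f)) := by
    rw [Arrow.isIso_iff_isIso_of_isIso
      (Abelian.PreservesCoimageImageComparison.iso (Comma.fst F (𝟭 B)) f).hom]
    infer_instance
  have h₂ : IsIso ((Comma.snd F (𝟭 B)).map (Abelian.coimageImageComparison f)) := by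
    rw [Arrow.isIso_iff_isIso_of_isIso
      (Abelian.PreservesCoimageImageComparison.iso (Comma.snd F (𝟭 B)) f).hom]
    infer_instance
  exact (Comma.isoMk (asIso ((Comma.fst F (𝟭 B)).map (Abelian.coimageImageComparison f)))
    (asIso ((Comma.snd F (𝟭 B)).map (Abelian.coimageImageComparison f)))
    (Abelian.coimageImageComparison f).w).isIso_hom

/-- The left comma category of a right exact functor is abelian. -/
instance : Abelian (LeftComma F) := Abelian.ofCoimageImageComparisonIsIso

end

/-- The functor `(Y, X, φ) ↦ Coker φ`. -/
def cokerFunctor : LeftComma F ⥤ B where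
  obj M := cokernel M.hom
  map f := cokernel.map _ _ (F.map f.left) f.right f.w.symm

/-- The functor `X ↦ (0, X)`. -/
def zeroLeft : B ⥤ LeftComma F where
  obj X := { left := 0, right := X, hom := 0 }
  map f := { left := 0, right := f, w := by simp }
  map_id X := by ext; rfl

/-- The functor `Y ↦ (Y, F Y, id)`. -/
def freeFunctor : A ⥤ LeftComma F where
  obj Y := { left := Y, right := F.obj Y, hom := 𝟙 _ }
  map f := { left := f, right := F.map f }

/-- The functor `(Y, X, φ) ↦ Y`. -/
abbrev leftFunctor : LeftComma F ⥤ A := Comma.fst F (𝟭 B)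

instance : (cokerFunctor F).Additive where
  map_add {M N f g} := by
    apply coequalizer.hom_ext
    erw [Preadditive.comp_add]
    simp [cokerFunctor]
    rfl

instance : (zeroLeft F).Additive where
  map_add {X Y f g} := by
    ext
    · exact IsZero.eq_of_src (isZero_zero A) _ _
    · rfl

instance : (freeFunctor F).Additive where
  map_add {X Y f g} := by
    ext
    · rfl
    · exact F.map_add

end LeftComma

end GorensteinComma

end

open GorensteinComma

noncomputable section

namespace GorensteinComma

/-! ### Two-sided dependent choice -/

/-! Sending a Gorenstein projective object to a complete resolution embeds the stable category into
the homotopy category of complexes. Every morphism lifts to complete resolutions, every chain map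
induces a morphism on the resolved objects, and a lift is null-homotopic exactly when the morphism
factors through a projective object (`Resolution.quotient_map_eq_iff`). The essential image is
closed under shifts and mapping cones, so the stable category inherits a triangulated structure. It
is the prescribed one: the object resolved by the cone of a lift of `u` is the pushout of `u` and `X
⟶ P(X)` (`exists_isPushout_cone`), once the resolution of `X` is chosen to have `P(X)` in degree
zero (`Cosyzygy.exists_resolution`).

An additive functor that preserves epimorphisms, projective objects and complete resolutions then
induces an exact functor on stable categories, namely the restriction of its termwise action on the
homotopy category. So exactness and preservation of Gorenstein projectives reduce to showing that
the four functors preserve projective objects and complete resolutions. The structure map `φ` of a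
projective object of the comma category is a split monomorphism, with projective `Y` and `Coker φ`.
Exactness for the first and third functors comes from (P1); (P2) gives Hom-exactness for `X ↦ (0,
X)` and, through the cokernel complex, for `(Y, X) ↦ Y`.

The adjunctions exist already between the abelian categories and descend, together with the
invertible counit of `(i^*, i_*)` and the invertible unit of `(j_!, j^*)`; this gives full
faithfulness. Finally, `φ` is a monomorphism for every Gorenstein projective `(Y, X)`, because the
object embeds into a projective one and `F` keeps the first component of this embedding monic. Hence
`0 ⟶ (Y, F Y) ⟶ (Y, X) ⟶ (0, Coker φ) ⟶ 0` is exact, and short exact sequences of Gorenstein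
projectives give distinguished triangles. -/

lemma exists_int_section {T : ℤ → Type*} (r : ∀ n, T n → T (n + 1) → Prop)
    (up : ∀ n (x : T n), ∃ y, r n x y) (down : ∀ n (y : T (n + 1)), ∃ x, r n x y) (x₀ : T 0) :
    ∃ s : ∀ n, T n, s 0 = x₀ ∧ ∀ n, r n (s n) (s (n + 1)) := by
  choose a ha using up
  choose b hb using down
  let sp : ∀ n : ℕ, T (Int.ofNat n) := fun n => Nat.rec x₀ (fun n x => a (Int.ofNat n) x) n
  let sn : ∀ n : ℕ, T (Int.negSucc n) := fun n =>
    Nat.rec (b (Int.negSucc 0) x₀) (fun n x => b (Int.negSucc (n + 1)) x) n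
  let s : ∀ n, T n := fun n => Int.rec sp sn n
  refine ⟨s, rfl, fun n => ?_⟩
  obtain n | (_ | n) := n
  · exact ha (Int.ofNat n) (sp n)
  · exact hb (Int.negSucc 0) x₀
  · exact hb (Int.negSucc (n + 1)) (sn n)

section Resolutions

variable {C : Type u} [Category.{v} C] [Abelian C]

/-! ### Exactness of complexes -/

lemma exact_sc' {K : CochainComplex C ℤ} (hK : K.Acyclic) (i j k : ℤ) (hij : i + 1 = j)
    (hjk : j + 1 = k) : (K.sc' i j k).Exact :=
  (K.exactAt_iff' i j k (by simp; lia) (by simp; lia)).1 (hK j)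

/-- Morphisms from a test object serve as elements, and an epimorphism onto the test object as the
choice of a preimage; with `acyclic_of_refinement` this permits element chases in any abelian
category. -/
lemma exists_refinement {K : CochainComplex C ℤ} (hK : K.Acyclic) (i j k : ℤ) (hij : i + 1 = j)
    (hjk : j + 1 = k) {T : C} (x : T ⟶ K.X j) (hx : x ≫ K.d j k = 0) :
    ∃ (T' : C) (π : T' ⟶ T) (_ : Epi π) (y : T' ⟶ K.X i), π ≫ x = y ≫ K.d i j :=
  (exact_sc' hK i j k hij hjk).exact_up_to_refinements x hx

lemma acyclic_of_refinement {K : CochainComplex C ℤ}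
    (h : ∀ (i j k : ℤ) (_ : i + 1 = j) (_ : j + 1 = k) (T : C) (x : T ⟶ K.X j),
      x ≫ K.d j k = 0 →
        ∃ (T' : C) (π : T' ⟶ T) (_ : Epi π) (y : T' ⟶ K.X i), π ≫ x = y ≫ K.d i j) :
    K.Acyclic := fun j => by
  rw [K.exactAt_iff' (j - 1) j (j + 1) (by simp) (by simp),
    ShortComplex.exact_iff_exact_up_to_refinements]
  exact fun T x hx => h (j - 1) j (j + 1) (by lia) rfl T x hx

lemma exists_lift_of_projective {K : CochainComplex C ℤ} (hK : K.Acyclic) (i j k : ℤ)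
    (hij : i + 1 = j) (hjk : j + 1 = k) {Q : C} (hQ : Projective Q) (x : Q ⟶ K.X j)
    (hx : x ≫ K.d j k = 0) : ∃ y : Q ⟶ K.X i, y ≫ K.d i j = x :=
  ⟨(exact_sc' hK i j k hij hjk).liftFromProjective x hx,
    (exact_sc' hK i j k hij hjk).liftFromProjective_comp x hx⟩

/-! ### Complete resolutions of an object -/

/-- A complete projective resolution `K`, together with a factorization of `K⁻¹ ⟶ K⁰` through
an epimorphism to `X` and a monomorphism from `X`. -/
structure Resolution (X : C) where
  K : CochainComplex C ℤ
  complete : IsCompleteResolution K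
  p : K.X (-1) ⟶ X
  i : X ⟶ K.X 0
  epi_p : Epi p
  mono_i : Mono i
  fac : p ≫ i = K.d (-1) 0

attribute [instance] Resolution.epi_p Resolution.mono_i

attribute [simp] Resolution.fac

@[simp]
lemma Resolution.fac_assoc {X T : C} (r : Resolution X) (f : r.K.X 0 ⟶ T) :
    r.p ≫ r.i ≫ f = r.K.d (-1) 0 ≫ f := by
  rw [← r.fac, Category.assoc]

namespace Resolution

lemma gproj {X : C} (r : Resolution X) : GProj C X := by
  have : StrongEpi r.p := strongEpi_of_epi _
  exact ⟨r.K, r.complete, ⟨image.isoStrongEpiMono r.p r.i r.fac⟩⟩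

/-- The complete resolution `K` as a resolution of the image of `K⁻¹ ⟶ K⁰`. -/
def ofComplete (K : CochainComplex C ℤ) (hK : IsCompleteResolution K) :
    Resolution (image (K.d (-1) 0)) where
  K := K
  complete := hK
  p := factorThruImage _
  i := image.ι _
  epi_p := inferInstance
  mono_i := inferInstance
  fac := image.fac _

/-- Transport of a resolution along an isomorphism. -/
def ofIso {X Y : C} (r : Resolution X) (e : X ≅ Y) : Resolution Y where
  K := r.K
  complete := r.complete
  p := r.p ≫ e.hom
  i := e.inv ≫ r.i
  epi_p := inferInstance
  mono_i := inferInstance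
  fac := by simp

lemma exists_of_gproj {X : C} (hX : GProj C X) : Nonempty (Resolution X) := by
  obtain ⟨K, hK, ⟨e⟩⟩ := hX
  exact ⟨(ofComplete K hK).ofIso e.symm⟩

variable {X Y Z : C} (r : Resolution X) (s : Resolution Y) (t : Resolution Z)

@[simp]
lemma d_p : r.K.d (-2) (-1) ≫ r.p = 0 := by
  simp [← cancel_mono r.i]

@[simp]
lemma d_p_assoc {T : C} (f : X ⟶ T) : r.K.d (-2) (-1) ≫ r.p ≫ f = 0 := by
  rw [← Category.assoc, d_p, zero_comp]

@[simp]
lemma i_d : r.i ≫ r.K.d 0 1 = 0 := by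
  rw [← cancel_epi r.p, fac_assoc]
  simp

/-- Acyclicity makes `r.p` a cokernel of the differential before it; dually, in the next lemma,
`r.i` is a kernel of the differential after it. -/
lemma exists_desc {T : C} (g : r.K.X (-1) ⟶ T) (hg : r.K.d (-2) (-1) ≫ g = 0) :
    ∃ g' : X ⟶ T, r.p ≫ g' = g := by
  have hS : (ShortComplex.mk (r.K.d (-2) (-1)) r.p r.d_p).Exact := by
    rw [ShortComplex.exact_iff_exact_up_to_refinements]
    intro T x (hx : x ≫ r.p = 0)
    exact exists_refinement r.complete.acyclic (-2) (-1) 0 (by lia) (by lia) x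
      (by rw [← r.fac, reassoc_of% hx, zero_comp])
  exact ⟨hS.desc g hg, hS.g_desc g hg⟩

lemma exists_lift {T : C} (g : T ⟶ r.K.X 0) (hg : g ≫ r.K.d 0 1 = 0) :
    ∃ g' : T ⟶ X, g' ≫ r.i = g := by
  have hS : (ShortComplex.mk r.i (r.K.d 0 1) r.i_d).Exact := by
    rw [ShortComplex.exact_iff_exact_up_to_refinements]
    intro T x (hx : x ≫ r.K.d 0 1 = 0)
    obtain ⟨T', π, hπ, y, hy⟩ := exists_refinement r.complete.acyclic (-1) 0 1 (by lia) (by lia)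
      x hx
    exact ⟨T', π, hπ, y ≫ r.p, by simpa using hy⟩
  exact ⟨hS.lift g hg, hS.lift_f g hg⟩

/-- Projective objects are injective relative to `r.i`: the composite `r.p ≫ a` is a cocycle of
`Hom(K, Q)`, so Hom-exactness makes it a coboundary. -/
lemma exists_extend {Q : C} (hQ : Projective Q) (a : X ⟶ Q) : ∃ a' : r.K.X 0 ⟶ Q, r.i ≫ a' = a := by
  obtain ⟨g, hg⟩ := r.complete.homExact Q hQ (-2) (-1) 0 (by lia) (by lia) (r.p ≫ a) (by simp)
  refine ⟨g, ?_⟩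
  rw [← cancel_epi r.p, fac_assoc, hg]

/-- A morphism of complexes that induces `f` on the resolved objects. -/
def Covers (f : X ⟶ Y) (φ : r.K ⟶ s.K) : Prop := r.p ≫ f = φ.f (-1) ≫ s.p

variable {r s t} in
lemma Covers.i_comp {f : X ⟶ Y} {φ : r.K ⟶ s.K} (h : Covers r s f φ) :
    r.i ≫ φ.f 0 = f ≫ s.i := by
  have h' : r.p ≫ f = φ.f (-1) ≫ s.p := h
  rw [← cancel_epi r.p, reassoc_of% h', fac_assoc, s.fac, φ.comm]

lemma covers_id : Covers r r (𝟙 X) (𝟙 r.K) := by simp [Covers]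

variable {r s t} in
lemma Covers.comp {f : X ⟶ Y} {g : Y ⟶ Z} {φ : r.K ⟶ s.K} {ψ : s.K ⟶ t.K} (h : Covers r s f φ)
    (h' : Covers s t g ψ) : Covers r t (f ≫ g) (φ ≫ ψ) := by
  dsimp [Covers] at h h' ⊢
  rw [reassoc_of% h, h', Category.assoc]

variable {r s} in
lemma Covers.add {f g : X ⟶ Y} {φ ψ : r.K ⟶ s.K} (h : Covers r s f φ)
    (h' : Covers r s g ψ) : Covers r s (f + g) (φ + ψ) := by
  dsimp [Covers] at h h' ⊢
  rw [Preadditive.comp_add, h, h', Preadditive.add_comp]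

variable {r s} in
lemma Covers.sub {f g : X ⟶ Y} {φ ψ : r.K ⟶ s.K} (h : Covers r s f φ)
    (h' : Covers r s g ψ) : Covers r s (f - g) (φ - ψ) := by
  dsimp [Covers] at h h' ⊢
  rw [Preadditive.comp_sub, h, h', Preadditive.sub_comp]

/-- Every morphism of complexes induces a morphism on the resolved objects. -/
lemma exists_covered (φ : r.K ⟶ s.K) : ∃ f : X ⟶ Y, Covers r s f φ :=
  r.exists_desc (φ.f (-1) ≫ s.p) (by rw [← φ.comm_assoc, d_p, comp_zero])

/-- Every morphism lifts to the complete resolutions. -/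
lemma exists_covers (f : X ⟶ Y) : ∃ φ : r.K ⟶ s.K, Covers r s f φ := by
  -- This condition lets a component be continued both ways: upwards by Hom-exactness of the source,
  -- downwards by projectivity of its terms and acyclicity of the target.
  let T : ℤ → Type v := fun n =>
    { a : r.K.X n ⟶ s.K.X n // r.K.d (n - 1) n ≫ a ≫ s.K.d n (n + 1) = 0 }
  have up : ∀ n (x : T n), ∃ y : T (n + 1),
      r.K.d n (n + 1) ≫ y.1 = x.1 ≫ s.K.d n (n + 1) := by
    rintro n ⟨a, ha⟩
    obtain ⟨b, hb⟩ := r.complete.homExact _ (s.complete.projective (n + 1)) (n - 1) n (n + 1)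
      (by lia) rfl (a ≫ s.K.d n (n + 1)) ha
    refine ⟨⟨b, ?_⟩, hb⟩
    have e : n + 1 - 1 = n := by lia
    rw [e, reassoc_of% hb]
    simp
  have down : ∀ n (y : T (n + 1)), ∃ x : T n,
      r.K.d n (n + 1) ≫ y.1 = x.1 ≫ s.K.d n (n + 1) := by
    rintro n ⟨b, hb⟩
    have e : n + 1 - 1 = n := by lia
    rw [e] at hb
    obtain ⟨a, ha⟩ := exists_lift_of_projective s.complete.acyclic n (n + 1) (n + 1 + 1) rfl rfl
      (r.complete.projective n) (r.K.d n (n + 1) ≫ b) (by rw [Category.assoc, hb])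
    exact ⟨⟨a, by rw [ha]; simp⟩, ha.symm⟩
  obtain ⟨a₀, ha₀⟩ := r.exists_extend (s.complete.projective 0) (f ≫ s.i)
  obtain ⟨x, hx₀, hx⟩ := exists_int_section (T := T) _ up down ⟨a₀, by
    change r.K.d (-1) 0 ≫ a₀ ≫ s.K.d 0 1 = 0
    rw [← r.fac, Category.assoc, reassoc_of% ha₀, i_d, comp_zero, comp_zero]⟩
  refine ⟨{ f := fun n => (x n).1, comm' := ?_ }, ?_⟩
  · rintro i j rfl
    exact (hx i).symm
  · have h₁ : r.K.d (-1) 0 ≫ a₀ = (x (-1)).1 ≫ s.K.d (-1) 0 := by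
      have := hx (-1)
      change r.K.d (-1) 0 ≫ (x 0).1 = _ at this
      rw [hx₀] at this
      exact this
    dsimp [Covers]
    rw [← cancel_mono s.i, Category.assoc, Category.assoc, s.fac, ← h₁, ← r.fac, Category.assoc,
      ha₀]

variable {r s} in
/-- A lift of a morphism that factors through a projective object is null-homotopic. -/
lemma Covers.homotopy_zero {f : X ⟶ Y} {φ : r.K ⟶ s.K} (h : Covers r s f φ) {Q : C}
    (hQ : Projective Q) (a : X ⟶ Q) (b : Q ⟶ Y) (hab : f = a ≫ b) :
    Nonempty (Homotopy φ 0) := by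
  have hh : r.p ≫ f = φ.f (-1) ≫ s.p := h
  obtain ⟨a', ha'⟩ := r.exists_extend hQ a
  have hb' := Projective.factorThru_comp b s.p
  set b' := Projective.factorThru b s.p
  -- A component of a homotopy is admissible when `φ - a ≫ d` is a cocycle, which is what the
  -- construction of the next component requires.
  let T : ℤ → Type v := fun n => { a : r.K.X n ⟶ s.K.X (n - 1) //
    r.K.d (n - 1) n ≫ a ≫ s.K.d (n - 1) n = r.K.d (n - 1) n ≫ φ.f n }
  let e (n : ℤ) : s.K.X (n + 1 - 1) ≅ s.K.X n := s.K.XIsoOfEq (by lia)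
  let R : ∀ n, T n → T (n + 1) → Prop := fun n x y =>
    φ.f n = r.K.d n (n + 1) ≫ y.1 ≫ (e n).hom + x.1 ≫ s.K.d (n - 1) n
  have up : ∀ n (x : T n), ∃ y : T (n + 1), R n x y := by
    rintro n ⟨a, ha⟩
    obtain ⟨b, hb⟩ := r.complete.homExact _ (s.complete.projective n) (n - 1) n (n + 1)
      (by lia) rfl (φ.f n - a ≫ s.K.d (n - 1) n) (by rw [Preadditive.comp_sub, ha, sub_self])
    refine ⟨⟨b ≫ (e n).inv, ?_⟩, ?_⟩
    · have : n + 1 - 1 = n := by lia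
      simp only [Category.assoc, e, HomologicalComplex.XIsoOfEq_inv_comp_d]
      have h₂ : r.K.d n (n + 1) ≫ b ≫ s.K.d n (n + 1) = r.K.d n (n + 1) ≫ φ.f (n + 1) := by
        rw [reassoc_of% hb]
        simp
      convert h₂
    · simp [R, hb]
  have down : ∀ n (y : T (n + 1)), ∃ x : T n, R n x y := by
    rintro n ⟨b, hb⟩
    have hb₂ : r.K.d n (n + 1) ≫ (b ≫ (e n).hom) ≫ s.K.d n (n + 1) =
        r.K.d n (n + 1) ≫ φ.f (n + 1) := by
      simp only [Category.assoc, e, HomologicalComplex.XIsoOfEq_hom_comp_d]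
      have : n + 1 - 1 = n := by lia
      convert hb <;> exact this.symm
    obtain ⟨a, ha⟩ := exists_lift_of_projective s.complete.acyclic (n - 1) n (n + 1) (by lia) rfl
      (r.complete.projective n) (φ.f n - r.K.d n (n + 1) ≫ b ≫ (e n).hom) (by
        simp only [Preadditive.sub_comp, Category.assoc] at hb₂ ⊢
        rw [hb₂]
        simp)
    exact ⟨⟨a, by simp [ha]⟩, by simp [R, ha]⟩
  -- In degree zero the homotopy is `K⁰ ⟶ Q ⟶ L⁻¹` (`K`, `L` resolving `X`, `Y`): `a` is extended
  -- along the inclusion of `X` and `b` is lifted along the projection to `Y`.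
  obtain ⟨x, hx₀, hx⟩ := exists_int_section (T := T) R up down ⟨a' ≫ b', by
    change r.K.d (-1) 0 ≫ (a' ≫ b') ≫ s.K.d (-1) 0 = r.K.d (-1) 0 ≫ φ.f 0
    simp only [← s.fac, ← r.fac, Category.assoc, h.i_comp, hab, reassoc_of% ha',
      reassoc_of% hb']⟩
  refine ⟨{
    hom := fun i j => if hij : j + 1 = i then (x i).1 ≫ (s.K.XIsoOfEq (by lia)).hom else 0
    zero := fun i j hij => dif_neg hij
    comm := fun n => ?_ }⟩
  rw [dNext_eq _ (show (ComplexShape.up ℤ).Rel n (n + 1) from rfl),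
    prevD_eq _ (show (ComplexShape.up ℤ).Rel (n - 1) n by simp)]
  simpa [R, e] using hx n

variable {r s} in
/-- If a null-homotopic morphism covers `f`, then `f` factors through a projective object. -/
lemma Covers.exists_fac_of_homotopy {f : X ⟶ Y} {φ : r.K ⟶ s.K} (h : Covers r s f φ)
    (H : Homotopy φ 0) : ∃ (Q : C) (a : X ⟶ Q) (b : Q ⟶ Y), Projective Q ∧ f = a ≫ b := by
  -- Of the two terms of the homotopy formula in degree `-1`, the one ending in the differential
  -- from degree `-2` dies under `s.p`; the other passes through the projective `K⁰`.
  refine ⟨_, r.i, H.hom 0 (-1) ≫ s.p, r.complete.projective 0, ?_⟩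
  have h' : r.p ≫ f = φ.f (-1) ≫ s.p := h
  have := H.comm (-1)
  rw [dNext_eq _ (show (ComplexShape.up ℤ).Rel (-1) 0 by simp),
    prevD_eq _ (show (ComplexShape.up ℤ).Rel (-2) (-1) by simp)] at this
  rw [← cancel_epi r.p, h', this]
  simp

end Resolution

end Resolutions

section Splice

variable {C : Type u} [Category.{v} C] [Abelian C]

/-! ### Splicing complete resolutions along a cosyzygy sequence -/

namespace Splice

variable {G : GP C} (c : Cosyzygy G) (r : Resolution G.obj) (s : Resolution c.obj.obj)

/-- The objects of the spliced complex. -/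
def X : ℤ → C
  | .ofNat 0 => c.P
  | .ofNat (n + 1) => s.K.X n
  | .negSucc n => r.K.X (.negSucc n)

/-- The differentials of the spliced complex. -/
def d : ∀ n : ℤ, X c r s n ⟶ X c r s (n + 1)
  | .ofNat 0 => (c.π ≫ s.i : c.P ⟶ s.K.X 0)
  | .ofNat (n + 1) => (s.K.d n (n + 1) : s.K.X n ⟶ s.K.X (n + 1))
  | .negSucc 0 => (r.p ≫ c.ι : r.K.X (-1) ⟶ c.P)
  | .negSucc (n + 1) => (r.K.d (.negSucc (n + 1)) (.negSucc n) :
      r.K.X (.negSucc (n + 1)) ⟶ r.K.X (.negSucc n))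

lemma d_comp_d (i : ℤ) : d c r s i ≫ d c r s (i + 1) = 0 := by
  obtain (_ | n) | (_ | _ | n) := i
  · change (c.π ≫ s.i) ≫ s.K.d 0 1 = 0
    simp
  · exact s.K.d_comp_d n (n + 1) (n + 1 + 1)
  · change (r.p ≫ c.ι) ≫ c.π ≫ s.i = 0
    simp [reassoc_of% c.zero]
  · exact r.d_p_assoc c.ι
  · exact r.K.d_comp_d _ _ _

/-- The spliced complex. -/
def complex : CochainComplex C ℤ := CochainComplex.of (X c r s) (d c r s) (d_comp_d c r s)

lemma complex_d (n : ℤ) : (complex c r s).d n (n + 1) = d c r s n := CochainComplex.of_d _ _ _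

/-- Only the junction degrees `-1`, `0`, `1` need an argument. Exactness there uses that `c` is
short exact. Hom-exactness at `-1` is the extension property of `c`, and at `0` that of `s`. -/
lemma complete : IsCompleteResolution (complex c r s) where
  projective n := by
    obtain (_ | n) | n := n
    · exact c.projective
    · exact s.complete.projective n
    · exact r.complete.projective _
  acyclic := by
    have : Mono c.ι := c.shortExact.mono_f
    have : Epi c.π := c.shortExact.epi_g
    refine acyclic_of_refinement ?_
    rintro i _ _ rfl rfl T x hx
    rw [complex_d] at hx ⊢
    -- The index `i` is one below the degree where exactness is tested, so the junction degrees `1`,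
    -- `0`, `-1` are the first, third and fourth cases.
    obtain (_ | n) | (_ | _ | n) := i
    · change T ⟶ s.K.X 0 at x
      obtain ⟨x', hx'⟩ := s.exists_lift x hx
      obtain ⟨T', π, hπ, y, hy⟩ := surjective_up_to_refinements_of_epi c.π x'
      refine ⟨T', π, hπ, y, ?_⟩
      change π ≫ x = y ≫ c.π ≫ s.i
      rw [← hx', reassoc_of% hy]
    · exact exists_refinement s.complete.acyclic n (n + 1) (n + 1 + 1) rfl rfl x hx
    · change T ⟶ c.P at x
      change x ≫ c.π ≫ s.i = 0 at hx
      have hx' : x ≫ c.π = 0 := by rw [← cancel_mono s.i, zero_comp, Category.assoc, hx]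
      obtain ⟨T', π, hπ, y, hy⟩ := surjective_up_to_refinements_of_epi r.p
        (c.shortExact.exact.lift x hx')
      refine ⟨T', π, hπ, y, ?_⟩
      change π ≫ x = y ≫ r.p ≫ c.ι
      rw [← reassoc_of% hy]
      exact congrArg (π ≫ ·) (c.shortExact.exact.lift_f x hx').symm
    · change T ⟶ r.K.X (-1) at x
      change x ≫ r.p ≫ c.ι = 0 at hx
      have hx' : x ≫ r.p = 0 := by rw [← cancel_mono c.ι, zero_comp, Category.assoc, hx]
      exact exists_refinement r.complete.acyclic (-2) (-1) 0 rfl rfl x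
        (by rw [← r.fac, reassoc_of% hx', zero_comp])
    · exact exists_refinement r.complete.acyclic (.negSucc (n + 2)) (.negSucc (n + 1))
        (.negSucc n) rfl rfl x hx
  homExact Q hQ := by
    have : Epi c.π := c.shortExact.epi_g
    rintro i _ _ rfl rfl f hf
    rw [complex_d] at hf ⊢
    obtain (_ | n) | (_ | _ | n) := i
    · change s.K.X 0 ⟶ Q at f
      change (c.π ≫ s.i) ≫ f = 0 at hf
      have hf' : s.i ≫ f = 0 := by rw [← cancel_epi c.π, comp_zero, ← Category.assoc, hf]
      exact s.complete.homExact Q hQ (-1) 0 1 rfl rfl f (by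
        rw [← s.fac, Category.assoc, hf', comp_zero])
    · exact s.complete.homExact Q hQ n (n + 1) (n + 1 + 1) rfl rfl f hf
    · change c.P ⟶ Q at f
      change (r.p ≫ c.ι) ≫ f = 0 at hf
      have hf' : c.ι ≫ f = 0 := by rw [← cancel_epi r.p, comp_zero, ← Category.assoc, hf]
      obtain ⟨g, hg⟩ := s.exists_extend hQ (c.shortExact.exact.desc f hf')
      refine ⟨g, ?_⟩
      change (c.π ≫ s.i) ≫ g = f
      rw [Category.assoc, hg]
      exact c.shortExact.exact.g_desc f hf'
    · change r.K.X (-1) ⟶ Q at f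
      obtain ⟨f', hf'⟩ := r.exists_desc f hf
      obtain ⟨g, hg⟩ := c.extend Q hQ f'
      refine ⟨g, ?_⟩
      change (r.p ≫ c.ι) ≫ g = f
      rw [← hf', ← hg, Category.assoc]
    · exact r.complete.homExact Q hQ (.negSucc (n + 2)) (.negSucc (n + 1)) (.negSucc n) rfl rfl
        f hf

end Splice

/-- Every cosyzygy sequence of `G` extends to a complete resolution of `G`. -/
lemma Cosyzygy.exists_resolution {G : GP C} (c : Cosyzygy G) :
    ∃ (r : Resolution G.obj) (e : r.K.X 0 ≅ c.P), r.i ≫ e.hom = c.ι := by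
  obtain ⟨r⟩ := Resolution.exists_of_gproj G.property
  obtain ⟨s⟩ := Resolution.exists_of_gproj c.obj.property
  exact ⟨{
    K := Splice.complex c r s
    complete := Splice.complete c r s
    p := r.p
    i := c.ι
    epi_p := r.epi_p
    mono_i := c.shortExact.mono_f
    fac := (Splice.complex_d c r s (.negSucc 0)).symm }, Iso.refl _, Category.comp_id _⟩

end Splice

section ToHomotopy

variable {C : Type u} [Category.{v} C] [Abelian C]

/-! ### The embedding of the stable category into the homotopy category -/

namespace Resolution

variable {X Y Z : C} (r : Resolution X) (s : Resolution Y) (t : Resolution Z)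

/-- The complete resolution in the homotopy category. -/
abbrev Kh : HomotopyCategory C (ComplexShape.up ℤ) := (HomotopyCategory.quotient _ _).obj r.K

/-- The class, in the homotopy category, of the lifts of a morphism to complete resolutions. -/
def hmap (f : X ⟶ Y) : r.Kh ⟶ s.Kh :=
  (HomotopyCategory.quotient _ _).map (r.exists_covers s f).choose

/-- Applied to the difference of two lifts, the two homotopy lemmas give both directions. One
implication makes the functor to the homotopy category well defined on stable classes, the other
makes it faithful. -/
lemma quotient_map_eq_iff {f g : X ⟶ Y} {φ ψ : r.K ⟶ s.K} (hφ : Covers r s f φ)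
    (hψ : Covers r s g ψ) :
    (HomotopyCategory.quotient _ _).map φ = (HomotopyCategory.quotient _ _).map ψ ↔
      ∃ (P : C) (a : X ⟶ P) (b : P ⟶ Y), Projective P ∧ f - g = a ≫ b := by
  rw [← sub_eq_zero, ← Functor.map_sub, HomotopyCategory.quotient_map_eq_zero_iff]
  constructor
  · rintro ⟨H⟩
    exact (hφ.sub hψ).exists_fac_of_homotopy H
  · rintro ⟨P, a, b, hP, h⟩
    exact (hφ.sub hψ).homotopy_zero hP a b h

lemma hmap_eq_iff {f g : X ⟶ Y} : hmap r s f = hmap r s g ↔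
      ∃ (P : C) (a : X ⟶ P) (b : P ⟶ Y), Projective P ∧ f - g = a ≫ b :=
  quotient_map_eq_iff r s (r.exists_covers s f).choose_spec (r.exists_covers s g).choose_spec

variable {r s} in
lemma Covers.hmap_eq {f : X ⟶ Y} {φ : r.K ⟶ s.K} (h : Covers r s f φ) :
    hmap r s f = (HomotopyCategory.quotient _ _).map φ :=
  (quotient_map_eq_iff r s (r.exists_covers s f).choose_spec h).2
    ⟨0, 0, 0, inferInstance, by simp⟩

lemma hmap_id : hmap r r (𝟙 X) = 𝟙 _ := by
  rw [r.covers_id.hmap_eq, CategoryTheory.Functor.map_id]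

lemma hmap_comp (f : X ⟶ Y) (g : Y ⟶ Z) : hmap r s f ≫ hmap s t g = hmap r t (f ≫ g) := by
  obtain ⟨φ, hφ⟩ := r.exists_covers s f
  obtain ⟨ψ, hψ⟩ := s.exists_covers t g
  rw [hφ.hmap_eq, hψ.hmap_eq, (hφ.comp hψ).hmap_eq, Functor.map_comp]

lemma hmap_add (f g : X ⟶ Y) : hmap r s (f + g) = hmap r s f + hmap r s g := by
  obtain ⟨φ, hφ⟩ := r.exists_covers s f
  obtain ⟨ψ, hψ⟩ := r.exists_covers s g
  rw [hφ.hmap_eq, hψ.hmap_eq, (hφ.add hψ).hmap_eq, Functor.map_add]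

lemma hmap_surjective (α : r.Kh ⟶ s.Kh) : ∃ f : X ⟶ Y, hmap r s f = α := by
  obtain ⟨φ, rfl⟩ := (HomotopyCategory.quotient _ _).map_surjective α
  obtain ⟨f, hf⟩ := r.exists_covered s φ
  exact ⟨f, hf.hmap_eq⟩

/-- Complete resolutions of isomorphic objects are homotopy equivalent. -/
def hiso (e : X ≅ Y) : r.Kh ≅ s.Kh where
  hom := hmap r s e.hom
  inv := hmap s r e.inv
  hom_inv_id := by rw [hmap_comp, e.hom_inv_id, hmap_id]
  inv_hom_id := by rw [hmap_comp, e.inv_hom_id, hmap_id]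

end Resolution

/-- A complete resolution of `X` that extends the chosen cosyzygy sequence. -/
def resolution (X : GP C) : Resolution X.obj := (cosyzygy X).exists_resolution.choose

/-- The degree zero term of the chosen resolution is the chosen projective object. -/
def resolutionIso (X : GP C) : (resolution X).K.X 0 ≅ (cosyzygy X).P :=
  (cosyzygy X).exists_resolution.choose_spec.choose

lemma resolution_i_comp (X : GP C) :
    (resolution X).i ≫ (resolutionIso X).hom = (cosyzygy X).ι :=
  (cosyzygy X).exists_resolution.choose_spec.choose_spec

variable (C) in
/-- Complete resolutions as a functor to the homotopy category. -/
def toHomotopyAux : GP C ⥤ HomotopyCategory C (ComplexShape.up ℤ) where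
  obj X := (resolution X).Kh
  map {X Y} f := (resolution X).hmap (resolution Y) f.hom
  map_id X := (resolution X).hmap_id
  map_comp {X Y Z} f g := ((resolution X).hmap_comp (resolution Y) (resolution Z) f.hom g.hom).symm

variable (C) in
/-- The embedding of the stable category into the homotopy category given by complete
resolutions. -/
def toHomotopy : StableGP C ⥤ HomotopyCategory C (ComplexShape.up ℤ) :=
  CategoryTheory.Quotient.lift _ (toHomotopyAux C)
    (fun X Y _ _ h => ((resolution X).hmap_eq_iff (resolution Y)).2 h)

instance : (toHomotopy C).Full where
  map_surjective {X Y} α := by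
    obtain ⟨f, hf⟩ := (resolution X.as).hmap_surjective (resolution Y.as) α
    exact ⟨(toStable C).map (ObjectProperty.homMk f), hf⟩

instance : (toHomotopy C).Faithful where
  map_injective {X Y} f g h := by
    obtain ⟨f, rfl⟩ := (toStable C).map_surjective f
    obtain ⟨g, rfl⟩ := (toStable C).map_surjective g
    exact CategoryTheory.Quotient.sound _ (((resolution X.as).hmap_eq_iff (resolution Y.as)).1 h)

instance : (toHomotopy C).Additive where
  map_add {X Y} f g := by
    obtain ⟨f, rfl⟩ := (toStable C).map_surjective f
    obtain ⟨g, rfl⟩ := (toStable C).map_surjective g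
    rw [← Functor.map_add]
    exact (resolution X.as).hmap_add (resolution Y.as) f.hom g.hom

/-- The image of a Gorenstein projective object is isomorphic to any of its complete
resolutions. -/
lemma mem_essImage_toHomotopy {K : CochainComplex C ℤ} (hK : IsCompleteResolution K) :
    (toHomotopy C).essImage ((HomotopyCategory.quotient _ _).obj K) :=
  ⟨(toStable C).obj ⟨_, (Resolution.ofComplete K hK).gproj⟩,
    ⟨(resolution _).hiso (Resolution.ofComplete K hK) (Iso.refl _)⟩⟩

/-! ### Shifts and mapping cones of complete resolutions -/

lemma IsCompleteResolution.shift {K : CochainComplex C ℤ} (hK : IsCompleteResolution K) (n : ℤ) :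
    IsCompleteResolution (K⟦n⟧) where
  projective i := hK.projective (i + n)
  acyclic i := ShortComplex.exact_of_iso
    ((CochainComplex.shiftShortComplexFunctorIso C n i (n + i) rfl).symm.app K) (hK.acyclic _)
  homExact P hP i j k hij hjk f hf := by
    change K.X (j + n) ⟶ P at f
    obtain ⟨g, hg⟩ := hK.homExact P hP (i + n) (j + n) (k + n) (by lia) (by lia) f (by
      have h : (n.negOnePow • K.d (i + n) (j + n)) ≫ f = 0 := hf
      rw [Linear.units_smul_comp] at h
      exact (smul_eq_zero_iff_eq _).1 h)
    refine ⟨n.negOnePow • g, ?_⟩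
    change (n.negOnePow • K.d (j + n) (k + n)) ≫ (n.negOnePow • g) = f
    rw [Linear.units_smul_comp, Linear.comp_units_smul, smul_smul, Int.units_mul_self, one_smul]
    exact hg

open CochainComplex in
-- Acyclic complexes form a triangulated subcategory, which gives acyclicity. Hom-exactness is
-- checked by components: a cocycle on the cone is solved first on `L`, and its defect on `K` is
-- again a cocycle.
lemma IsCompleteResolution.cone {K L : CochainComplex C ℤ} (hK : IsCompleteResolution K)
    (hL : IsCompleteResolution L) (φ : K ⟶ L) : IsCompleteResolution (mappingCone φ) where
  projective n := by
    have := hK.projective (n + 1)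
    have := hL.projective n
    exact Projective.of_iso
      (HomologicalComplex.homotopyCofiber.XIsoBiprod φ n (n + 1) rfl).symm inferInstance
  acyclic := by
    rw [← HomotopyCategory.quotient_obj_mem_subcategoryAcyclic_iff_acyclic]
    refine (HomotopyCategory.subcategoryAcyclic C).ext_of_isTriangulatedClosed₃ _
      (HomotopyCategory.mappingCone_triangleh_distinguished φ) ?_ ?_
    · exact (HomotopyCategory.quotient_obj_mem_subcategoryAcyclic_iff_acyclic K).2 hK.acyclic
    · exact (HomotopyCategory.quotient_obj_mem_subcategoryAcyclic_iff_acyclic L).2 hL.acyclic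
  homExact P hP := by
    rintro i _ _ rfl rfl f hf
    obtain ⟨b, hb⟩ := hL.homExact P hP i (i + 1) (i + 1 + 1) rfl rfl
      ((mappingCone.inr φ).f (i + 1) ≫ f) (by
        rw [← (mappingCone.inr φ).comm_assoc, hf, comp_zero])
    have h₁ : (mappingCone.inl φ).v (i + 1) i (by lia) ≫ (mappingCone φ).d i (i + 1) ≫ f =
        (mappingCone.inl φ).v (i + 1) i (by lia) ≫ 0 := by rw [hf]
    rw [mappingCone.inl_v_d_assoc φ (i + 1) i (i + 1 + 1) (by lia) (by lia), comp_zero,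
      Preadditive.sub_comp, Category.assoc, Category.assoc, ← hb, φ.comm_assoc,
      ← Preadditive.comp_sub] at h₁
    -- By `h₁`, the difference of `φ ≫ b` and the `K`-component of `f` is a cocycle; `a` is a
    -- primitive of it.
    obtain ⟨a, ha⟩ := hK.homExact P hP (i + 1) (i + 1 + 1) (i + 1 + 1 + 1) rfl rfl _ h₁
    refine ⟨(mappingCone.fst φ).1.v (i + 1 + 1) (i + 1 + 1 + 1) rfl ≫ a +
      (mappingCone.snd φ).v (i + 1 + 1) (i + 1 + 1) (by lia) ≫ b, ?_⟩
    rw [mappingCone.ext_from_iff φ (i + 1 + 1) (i + 1) rfl]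
    constructor
    · rw [mappingCone.inl_v_d_assoc φ (i + 1 + 1) (i + 1) (i + 1 + 1 + 1) (by lia) (by lia)]
      simp [ha]
    · rw [(mappingCone.inr φ).comm_assoc]
      simp [hb]

end ToHomotopy

/-! ### Commutative squares and isomorphisms of triangles -/

section

variable {D : Type u₂} [Category.{v₂} D]

lemma comp_comp_eq_of_squares {A₁ A₂ B₁ B₂ C₁ C₂ : D} {a : A₁ ⟶ A₂} {b : B₁ ⟶ B₂} {c : C₁ ⟶ C₂}
    {f₁ : A₁ ⟶ B₁} {f₂ : A₂ ⟶ B₂} {g₁ : B₁ ⟶ C₁} {g₂ : B₂ ⟶ C₂} (h : a ≫ f₂ = f₁ ≫ b)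
    (h' : b ≫ g₂ = g₁ ≫ c) : a ≫ f₂ ≫ g₂ = (f₁ ≫ g₁) ≫ c := by
  rw [reassoc_of% h, h', Category.assoc]

/-- Constructor for isomorphisms of triangles. -/
def triangleMkIso [HasShift D ℤ] {X₁ X₂ X₃ Y₁ Y₂ Y₃ : D} {f : X₁ ⟶ X₂} {g : X₂ ⟶ X₃}
    {h : X₃ ⟶ X₁⟦(1 : ℤ)⟧} {f' : Y₁ ⟶ Y₂} {g' : Y₂ ⟶ Y₃} {h' : Y₃ ⟶ Y₁⟦(1 : ℤ)⟧}
    (e₁ : X₁ ≅ Y₁) (e₂ : X₂ ≅ Y₂) (e₃ : X₃ ≅ Y₃) (comm₁ : f ≫ e₂.hom = e₁.hom ≫ f')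
    (comm₂ : g ≫ e₃.hom = e₂.hom ≫ g') (comm₃ : h ≫ e₁.hom⟦(1 : ℤ)⟧' = e₃.hom ≫ h') :
    Triangle.mk f g h ≅ Triangle.mk f' g' h' :=
  Triangle.isoMk (Triangle.mk f g h) (Triangle.mk f' g' h') e₁ e₂ e₃ comm₁ comm₂ comm₃

lemma distinguished_of_iso₃ [HasZeroObject D] [Preadditive D] [HasShift D ℤ]
    [∀ n : ℤ, (shiftFunctor D n).Additive] [Pretriangulated D] {X Y Z Z' : D} {f : X ⟶ Y}
    {g : Y ⟶ Z'} {h : Z' ⟶ X⟦(1 : ℤ)⟧} (mem : Triangle.mk f g h ∈ distTriang D) (e : Z ≅ Z') :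
    Triangle.mk f (g ≫ e.inv) (e.hom ≫ h) ∈ distTriang D :=
  isomorphic_distinguished _ mem _
    (triangleMkIso (Iso.refl _) (Iso.refl _) e (by simp) (by simp) (by simp))

end

/-! ### Triangulated structures induced along fully faithful functors -/

section Transport

variable {T : Type u₁} [Category.{v₁} T] {D : Type u₂} [Category.{v₂} D] (R : T ⥤ D)
  [R.Full] [R.Faithful]

section Shift

variable [HasShift D ℤ] (hR : ∀ (X : T) (n : ℤ), R.essImage ((R.obj X)⟦n⟧))

/-- The shift induced along a fully faithful functor whose essential image is stable under
shifts. -/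
@[reducible]
def inducedShift : HasShift T ℤ :=
  (Functor.FullyFaithful.ofFullyFaithful R).hasShift
    (fun n => Functor.essImage.liftFunctor (R ⋙ shiftFunctor D n) R (fun X => hR X n))
    (fun n => Functor.essImage.liftFunctorCompIso (R ⋙ shiftFunctor D n) R (fun X => hR X n))

/-- A fully faithful functor commutes with the shift that it induces. -/
@[reducible]
def inducedShiftCommShift :
    letI := inducedShift R hR
    R.CommShift ℤ :=
  Functor.CommShift.ofHasShiftOfFullyFaithful (Functor.FullyFaithful.ofFullyFaithful R)
    (fun n => Functor.essImage.liftFunctor (R ⋙ shiftFunctor D n) R (fun X => hR X n))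
    (fun n => Functor.essImage.liftFunctorCompIso (R ⋙ shiftFunctor D n) R (fun X => hR X n))

end Shift

variable [HasShift D ℤ] [HasShift T ℤ] [Preadditive T] [Preadditive D]
  [∀ n : ℤ, (shiftFunctor D n).Additive]

lemma shiftFunctor_additive_of_faithful {T : Type u₁} [Category.{v₁} T] [Preadditive T]
    [HasShift T ℤ] {D : Type u₂} [Category.{v₂} D] [Preadditive D] [HasShift D ℤ]
    (R : T ⥤ D) [R.Faithful] [R.Additive] [R.CommShift ℤ] (n : ℤ) [(shiftFunctor D n).Additive] :
    (shiftFunctor T n).Additive where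
  map_add {X Y f g} := R.map_injective (by
    rw [← cancel_mono ((R.commShiftIso n).hom.app Y), R.map_add, Preadditive.add_comp]
    have h (f : X ⟶ Y) := (R.commShiftIso n).hom.naturality f
    dsimp only [Functor.comp_map, Functor.comp_obj] at h ⊢
    rw [h, h, h, R.map_add, Functor.map_add, Preadditive.comp_add])

variable [R.CommShift ℤ] [R.Additive]
variable [HasZeroObject T] [HasZeroObject D] [∀ n : ℤ, (shiftFunctor T n).Additive]
  [Pretriangulated D]

/-- The pretriangulated structure induced along a fully faithful functor whose essential image
is stable under cones. -/
@[reducible]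
def inducedPretriangulated
    (hR : ∀ {X Y : T} (f : X ⟶ Y), ∃ (Z : T) (g : R.obj Y ⟶ R.obj Z)
      (h : R.obj Z ⟶ (R.obj X)⟦(1 : ℤ)⟧), Triangle.mk (R.map f) g h ∈ distTriang D) :
    Pretriangulated T where
  -- Each axiom is verified on images under `R` and pulled back by full faithfulness; closure under
  -- cones is needed only to complete a morphism to a triangle.
  distinguishedTriangles := R.mapTriangle.obj ⁻¹' (distTriang D)
  isomorphic_distinguished T₁ hT₁ T₂ e :=
    isomorphic_distinguished _ hT₁ _ (R.mapTriangle.mapIso e)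
  contractible_distinguished X :=
    isomorphic_distinguished _ (contractible_distinguished (R.obj X)) _
      (triangleMkIso (f := R.map (𝟙 X)) (g := R.map (0 : X ⟶ 0))
        (h := R.map (0 : 0 ⟶ X⟦(1 : ℤ)⟧) ≫ (R.commShiftIso (1 : ℤ)).hom.app X)
        (f' := 𝟙 (R.obj X)) (g' := (0 : R.obj X ⟶ 0)) (h' := 0) (Iso.refl _) (Iso.refl _)
        R.mapZeroObject (by simp) (by simp) (by simp))
  distinguished_cocone_triangle {X Y} f := by
    obtain ⟨Z, g, h, mem⟩ := hR f
    exact ⟨Z, R.preimage g, R.preimage (h ≫ (R.commShiftIso (1 : ℤ)).inv.app X),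
      isomorphic_distinguished _ mem _
        (triangleMkIso (f := R.map f) (g := R.map (R.preimage g))
          (h := R.map (R.preimage _) ≫ (R.commShiftIso (1 : ℤ)).hom.app X) (Iso.refl _)
          (Iso.refl _) (Iso.refl _) (by simp) (by simp) (by simp))⟩
  rotate_distinguished_triangle T :=
    (rotate_distinguished_triangle (R.mapTriangle.obj T)).trans
      (distinguished_iff_of_iso (R.mapTriangleRotateIso.app T))
  complete_distinguished_triangle_morphism T₁ T₂ hT₁ hT₂ a b comm := by
    obtain ⟨c, ⟨hc₁, hc₂⟩⟩ := complete_distinguished_triangle_morphism (R.mapTriangle.obj T₁)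
      (R.mapTriangle.obj T₂) hT₁ hT₂ (R.map a) (R.map b)
      (by
        change R.map T₁.mor₁ ≫ R.map b = R.map a ≫ R.map T₂.mor₁
        rw [← R.map_comp, comm, R.map_comp])
    change R.obj T₁.obj₃ ⟶ R.obj T₂.obj₃ at c
    change R.map T₁.mor₂ ≫ c = R.map b ≫ R.map T₂.mor₂ at hc₁
    change (R.map T₁.mor₃ ≫ (R.commShiftIso (1 : ℤ)).hom.app T₁.obj₁) ≫ (R.map a)⟦(1 : ℤ)⟧' =
      c ≫ R.map T₂.mor₃ ≫ (R.commShiftIso (1 : ℤ)).hom.app T₂.obj₁ at hc₂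
    refine ⟨R.preimage c, ⟨R.map_injective (by simpa using hc₁), R.map_injective ?_⟩⟩
    have := R.commShiftIso_hom_naturality a (1 : ℤ)
    rw [← cancel_mono ((Functor.commShiftIso R (1 : ℤ)).hom.app T₂.obj₁)]
    simpa using hc₂

end Transport

section StableTriangulated

variable {C : Type u} [Category.{v} C] [Abelian C]

/-! ### The triangulated structure of the stable category -/

/-- The object `Σ X` is the image of `K⁰ ⟶ K¹`: an element killed by `j` lifts to `P(X)`, is a cycle
there, hence comes from `X` and dies in `Σ X`. This `j` is the inclusion in the resolution of `Σ X`
by the shifted complex. -/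
lemma exists_suspension_mono (X : GP C) : ∃ j : (cosyzygy X).obj.obj ⟶ (resolution X).K.X 1,
    Mono j ∧ ((resolutionIso X).hom ≫ (cosyzygy X).π) ≫ j = (resolution X).K.d 0 1 := by
  obtain ⟨j, hj⟩ := exists_desc ((resolutionIso X).inv ≫ (resolution X).K.d 0 1) (by
    rw [← resolution_i_comp, Category.assoc, Iso.hom_inv_id_assoc, Resolution.i_d])
  have : Epi (cosyzygy X).π := (cosyzygy X).shortExact.epi_g
  refine ⟨j, ?_, by simp [hj]⟩
  rw [Preadditive.mono_iff_cancel_zero]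
  intro T x hx
  obtain ⟨T', π, hπ, y, hy⟩ := surjective_up_to_refinements_of_epi (cosyzygy X).π x
  have h₁ : (y ≫ (resolutionIso X).inv) ≫ (resolution X).K.d 0 1 = 0 := by
    rw [Category.assoc, ← hj, ← reassoc_of% hy, hx, comp_zero]
  obtain ⟨z, hz⟩ := (resolution X).exists_lift _ h₁
  rw [← cancel_epi π, comp_zero, hy]
  have hz' : y = z ≫ (cosyzygy X).ι := by
    rw [← resolution_i_comp, reassoc_of% hz]
    simp
  rw [hz', Category.assoc, (cosyzygy X).zero, comp_zero]

/-- The shift of the chosen resolution of `X` is a resolution of `Σ X`. The sign is the one that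
makes the mapping cone triangles correspond to the standard triangles. -/
def suspensionResolution (X : GP C) : Resolution (cosyzygy X).obj.obj where
  K := (resolution X).K⟦(1 : ℤ)⟧
  complete := (resolution X).complete.shift 1
  p := -((resolutionIso X).hom ≫ (cosyzygy X).π)
  i := (exists_suspension_mono X).choose
  epi_p := by
    have : Epi (cosyzygy X).π := (cosyzygy X).shortExact.epi_g
    exact inferInstanceAs (Epi (-((resolutionIso X).hom ≫ (cosyzygy X).π)))
  mono_i := (exists_suspension_mono X).choose_spec.1
  fac := by
    have h := (exists_suspension_mono X).choose_spec.2
    refine (Preadditive.neg_comp _ _).trans ((congrArg Neg.neg h).trans ?_)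
    exact (by simp : -(resolution X).K.d 0 1 = Int.negOnePow 1 • (resolution X).K.d 0 1)

/-- The shifted lift covers some morphism `Σ X ⟶ Σ Y`, which is also induced by `f`;
`suspension_unique` then identifies it stably with `h`. -/
lemma hmap_suspension {X Y : GP C} {f : X ⟶ Y} {h : (cosyzygy X).obj ⟶ (cosyzygy Y).obj}
    (hf : IsSuspensionOf f h) {φ : (resolution X).K ⟶ (resolution Y).K}
    (hφ : (resolution X).Covers (resolution Y) f.hom φ) :
    (suspensionResolution X).hmap (suspensionResolution Y) h.hom =
      (HomotopyCategory.quotient _ _).map (φ⟦(1 : ℤ)⟧') := by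
  obtain ⟨g, hg⟩ := (suspensionResolution X).exists_covered (suspensionResolution Y) (φ⟦(1 : ℤ)⟧')
  refine Eq.trans ?_ hg.hmap_eq
  rw [Resolution.hmap_eq_iff]
  have hg' : (-((resolutionIso X).hom ≫ (cosyzygy X).π)) ≫ g =
    φ.f 0 ≫ (-((resolutionIso Y).hom ≫ (cosyzygy Y).π)) := hg
  refine suspension_unique (Congruence.equivalence.refl f) hf (h' := ObjectProperty.homMk g)
    ⟨(resolutionIso X).inv ≫ φ.f 0 ≫ (resolutionIso Y).hom, ?_, ?_⟩
  · rw [← resolution_i_comp, ← resolution_i_comp]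
    have := hφ.i_comp
    simp [reassoc_of% this]
  · rw [← cancel_epi (resolutionIso X).hom]
    simpa using hg'

variable (C) in
/-- The embedding into the homotopy category carries the suspension to the shift. -/
def toHomotopySuspensionIso :
    toHomotopy C ⋙ shiftFunctor _ (1 : ℤ) ≅ suspension C ⋙ toHomotopy C :=
  NatIso.ofComponents (fun X =>
    ((HomotopyCategory.quotient C (ComplexShape.up ℤ)).commShiftIso (1 : ℤ)).symm.app
      (resolution X.as).K ≪≫
    (suspensionResolution X.as).hiso (resolution (cosyzygy X.as).obj) (Iso.refl _)) (by
    intro X Y f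
    obtain ⟨f, rfl⟩ := (toStable C).map_surjective f
    obtain ⟨φ, hφ⟩ := (resolution X.as).exists_covers (resolution Y.as) f.hom
    obtain ⟨h, hh⟩ : ∃ h, IsSuspensionOf f h ∧
        (suspension C).map ((toStable C).map f) = (toStable C).map h :=
      ⟨(exists_suspension f).choose, (exists_suspension f).choose_spec, rfl⟩
    dsimp only [Functor.comp_map, Functor.comp_obj]
    rw [hh.2]
    change ((resolution X.as).hmap (resolution Y.as) f.hom)⟦(1 : ℤ)⟧' ≫
      ((HomotopyCategory.quotient C (ComplexShape.up ℤ)).commShiftIso (1 : ℤ)).inv.app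
        (resolution Y.as).K ≫
      (suspensionResolution Y.as).hmap (resolution (cosyzygy Y.as).obj) (𝟙 _) =
      (((HomotopyCategory.quotient C (ComplexShape.up ℤ)).commShiftIso (1 : ℤ)).inv.app
        (resolution X.as).K ≫
      (suspensionResolution X.as).hmap (resolution (cosyzygy X.as).obj) (𝟙 _)) ≫
      (resolution (cosyzygy X.as).obj).hmap (resolution (cosyzygy Y.as).obj) h.hom
    refine comp_comp_eq_of_squares
      (b := (suspensionResolution X.as).hmap (suspensionResolution Y.as) h.hom) ?_ ?_
    · rw [hφ.hmap_eq]
      exact (((HomotopyCategory.quotient C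
        (ComplexShape.up ℤ)).commShiftIso (1 : ℤ)).inv.naturality φ).trans
        (congrArg (((HomotopyCategory.quotient C
          (ComplexShape.up ℤ)).commShiftIso (1 : ℤ)).inv.app (resolution X.as).K ≫ ·)
          (hmap_suspension hh.1 hφ).symm)
    · rw [Resolution.hmap_comp, Resolution.hmap_comp, Category.id_comp, Category.comp_id])

lemma toHomotopy_shift_mem (X : StableGP C) (n : ℤ) :
    (toHomotopy C).essImage (((toHomotopy C).obj X)⟦n⟧) := by
  obtain ⟨Y, ⟨e⟩⟩ := mem_essImage_toHomotopy ((resolution X.as).complete.shift n)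
  exact ⟨Y, ⟨e ≪≫ ((HomotopyCategory.quotient C (ComplexShape.up ℤ)).commShiftIso n).app
      (resolution X.as).K⟩⟩

lemma toHomotopy_cone {X Y : StableGP C} (f : X ⟶ Y) :
    ∃ (Z : StableGP C) (g : (toHomotopy C).obj Y ⟶ (toHomotopy C).obj Z)
      (h : (toHomotopy C).obj Z ⟶ ((toHomotopy C).obj X)⟦(1 : ℤ)⟧),
      Triangle.mk ((toHomotopy C).map f) g h ∈ distTriang _ := by
  obtain ⟨f, rfl⟩ := (toStable C).map_surjective f
  obtain ⟨φ, hφ⟩ := (resolution X.as).exists_covers (resolution Y.as) f.hom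
  obtain ⟨Z, ⟨e⟩⟩ := mem_essImage_toHomotopy
    ((resolution X.as).complete.cone (resolution Y.as).complete φ)
  have h : (toHomotopy C).map ((toStable C).map f) =
    (HomotopyCategory.quotient _ _).map φ := hφ.hmap_eq
  rw [h]
  exact ⟨Z, _, _,
    distinguished_of_iso₃ (HomotopyCategory.mappingCone_triangleh_distinguished φ) e⟩

variable (C) in
/-- The shift of the stable category. -/
@[reducible]
def stableShift : HasShift (StableGP C) ℤ :=
  inducedShift (toHomotopy C) toHomotopy_shift_mem

attribute [local instance] stableShift

instance toHomotopyCommShift : (toHomotopy C).CommShift ℤ :=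
  inducedShiftCommShift (toHomotopy C) toHomotopy_shift_mem

variable (C) in
lemma stableShift_additive (n : ℤ) : (shiftFunctor (StableGP C) n).Additive :=
  shiftFunctor_additive_of_faithful (toHomotopy C) n

attribute [local instance] stableShift_additive

variable (C) in
/-- The pretriangulated structure of the stable category. -/
@[reducible]
def stablePretriangulated : Pretriangulated (StableGP C) :=
  inducedPretriangulated (toHomotopy C) toHomotopy_cone

attribute [local instance] stablePretriangulated

instance : (toHomotopy C).IsTriangulated where
  map_distinguished _ hT := hT

variable (C) in
lemma stable_isTriangulated : IsTriangulated (StableGP C) :=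
  IsTriangulated.of_fully_faithful_triangulated_functor (toHomotopy C)

attribute [local instance] stable_isTriangulated

variable (C) in
/-- The shift of the stable category is the suspension. -/
def stableShiftIso : shiftFunctor (StableGP C) (1 : ℤ) ≅ suspension C :=
  ((Functor.FullyFaithful.ofFullyFaithful (toHomotopy C)).whiskeringRight _).preimageIso
    ((toHomotopy C).commShiftIso (1 : ℤ) ≪≫ toHomotopySuspensionIso C)

lemma map_stableShiftIso_inv (X : StableGP C) :
    (toHomotopy C).map ((stableShiftIso C).inv.app X) ≫
      ((toHomotopy C).commShiftIso (1 : ℤ)).hom.app X =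
        (toHomotopySuspensionIso C).inv.app X := by
  simp [stableShiftIso]

/-! ### Standard triangles -/

section Cone

variable {X Y : GP C} {u : X ⟶ Y} {φ : (resolution X).K ⟶ (resolution Y).K}

/-- The mapping cone of a lift of a morphism, as a resolution. -/
def coneResolution (φ : (resolution X).K ⟶ (resolution Y).K) :
    Resolution (image ((CochainComplex.mappingCone φ).d (-1) 0)) :=
  Resolution.ofComplete _ ((resolution X).complete.cone (resolution Y).complete φ)

/-- The Gorenstein projective object resolved by a mapping cone. -/
def coneObj (φ : (resolution X).K ⟶ (resolution Y).K) : GP C := ⟨_, (coneResolution φ).gproj⟩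

open CochainComplex in
-- In degree `-1` the cone is `K⁰ ⊕ L⁻¹`, where `K` and `L` resolve `X` and `Y`. The resolved object
-- is its quotient by the boundaries from `K⁻¹ ⊕ L⁻²`: those from `L⁻²` turn `L⁻¹` into `Y`, and
-- those from `K⁻¹` glue `K⁰ ≅ P(X)` to `Y` along `X`. This quotient is the pushout.
lemma exists_isPushout_cone (hφ : (resolution X).Covers (resolution Y) u.hom φ) :
    ∃ (v : Y ⟶ coneObj φ) (k : (cosyzygy X).P ⟶ (coneObj φ).obj)
      (w : coneObj φ ⟶ (cosyzygy X).obj),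
      IsPushout u.hom (cosyzygy X).ι v.hom k ∧ v ≫ w = 0 ∧ k ≫ w.hom = (cosyzygy X).π ∧
      (resolution Y).Covers (coneResolution φ) v.hom (mappingCone.inr φ) ∧
      (coneResolution φ).Covers (suspensionResolution X) w.hom (mappingCone.triangle φ).mor₃ := by
  let r := coneResolution φ
  let inl : (resolution X).K.X 0 ⟶ r.K.X (-1) := (mappingCone.inl φ).v 0 (-1) (by lia)
  let inr : (resolution Y).K.X (-1) ⟶ r.K.X (-1) := (mappingCone.inr φ).f (-1)
  have hφ' : (resolution X).p ≫ u.hom = φ.f (-1) ≫ (resolution Y).p := hφ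
  let inl' : (resolution X).K.X (-1) ⟶ r.K.X (-2) := (mappingCone.inl φ).v (-1) (-2) (by lia)
  let inr' : (resolution Y).K.X (-2) ⟶ r.K.X (-2) := (mappingCone.inr φ).f (-2)
  have hinl_d : inl' ≫ r.K.d (-2) (-1) = φ.f (-1) ≫ inr - (resolution X).K.d (-1) 0 ≫ inl :=
    mappingCone.inl_v_d φ (-1) (-2) 0 (by lia) (by lia)
  have hinr_d : inr' ≫ r.K.d (-2) (-1) = (resolution Y).K.d (-2) (-1) ≫ inr :=
    (mappingCone.inr φ).comm _ _
  have hinl : (resolution X).K.d (-1) 0 ≫ inl ≫ r.p = φ.f (-1) ≫ inr ≫ r.p := by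
    have h := congrArg (· ≫ r.p) hinl_d
    rw [Category.assoc, r.d_p, comp_zero, Preadditive.sub_comp, Category.assoc,
      Category.assoc] at h
    exact (sub_eq_zero.1 h.symm).symm
  have hext {T : C} {f g : r.K.X (-1) ⟶ T} (h₁ : inl ≫ f = inl ≫ g) (h₂ : inr ≫ f = inr ≫ g) :
      f = g := (mappingCone.ext_from_iff φ 0 (-1) (by lia) f g).2 ⟨h₁, h₂⟩
  have hext' {T : C} {f g : r.K.X (-2) ⟶ T} (h₁ : inl' ≫ f = inl' ≫ g)
      (h₂ : inr' ≫ f = inr' ≫ g) : f = g :=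
    (mappingCone.ext_from_iff φ (-1) (-2) (by lia) f g).2 ⟨h₁, h₂⟩
  have hdesc {T : C} (a : (resolution X).K.X 0 ⟶ T) (b : (resolution Y).K.X (-1) ⟶ T) :
      ∃ g : r.K.X (-1) ⟶ T, inl ≫ g = a ∧ inr ≫ g = b := by
    obtain ⟨g, h₁, h₂⟩ : ∃ g : (mappingCone φ).X (-1) ⟶ T,
        (mappingCone.inl φ).v 0 (-1) (by lia) ≫ g = a ∧ (mappingCone.inr φ).f (-1) ≫ g = b :=
      ⟨(mappingCone.fst φ).1.v (-1) 0 (by lia) ≫ a +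
        (mappingCone.snd φ).v (-1) (-1) (by lia) ≫ b, by simp, by simp⟩
    exact ⟨g, h₁, h₂⟩
  obtain ⟨v, hv⟩ := (resolution Y).exists_covered r (mappingCone.inr φ)
  obtain ⟨w, hw⟩ := r.exists_covered (suspensionResolution X) (mappingCone.triangle φ).mor₃
  have hv' : (resolution Y).p ≫ v = inr ≫ r.p := hv
  let m : r.K.X (-1) ⟶ (resolution X).K.X 0 := (mappingCone.triangle φ).mor₃.f (-1)
  -- The third morphism of the cone triangle is minus the projection to `K⟦1⟧`; this sign cancels
  -- the one in `suspensionResolution`, leaving `k ≫ w` equal to the projection with no sign.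
  have hm₁ : inl ≫ m = -𝟙 _ := mappingCone.inl_v_triangle_mor₃_f φ 0 (-1) (by lia)
  have hm₂ : inr ≫ m = 0 := mappingCone.inr_f_triangle_mor₃_f φ (-1)
  have hw' : r.p ≫ w = m ≫ (-((resolutionIso X).hom ≫ (cosyzygy X).π)) := hw
  have hw₁ : inl ≫ r.p ≫ w = (resolutionIso X).hom ≫ (cosyzygy X).π := by
    rw [hw', reassoc_of% hm₁]
    simp
  have hw₂ : inr ≫ r.p ≫ w = 0 := by rw [hw', reassoc_of% hm₂, zero_comp]
  have hom_ext {T : C} {f g : image ((mappingCone φ).d (-1) 0) ⟶ T} (h₁ : v ≫ f = v ≫ g)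
      (h₂ : ((resolutionIso X).inv ≫ inl ≫ r.p) ≫ f = ((resolutionIso X).inv ≫ inl ≫ r.p) ≫ g) :
      f = g := by
    rw [← cancel_epi r.p]
    refine hext ?_ ?_
    · simpa using h₂
    · rw [← reassoc_of% hv', ← reassoc_of% hv', h₁]
  have comm : u.hom ≫ v = (cosyzygy X).ι ≫ (resolutionIso X).inv ≫ inl ≫ r.p := by
    rw [← cancel_epi (resolution X).p, reassoc_of% hφ', hv', ← resolution_i_comp, Category.assoc,
      Iso.hom_inv_id_assoc, Resolution.fac_assoc, hinl]
  have exists_desc (s : PushoutCocone u.hom (cosyzygy X).ι) :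
      ∃ g : image ((mappingCone φ).d (-1) 0) ⟶ s.pt,
        v ≫ g = s.inl ∧ ((resolutionIso X).inv ≫ inl ≫ r.p) ≫ g = s.inr := by
    obtain ⟨g, hg₁, hg₂⟩ := hdesc ((resolutionIso X).hom ≫ s.inr) ((resolution Y).p ≫ s.inl)
    -- The map on `K⁰ ⊕ L⁻¹` kills the boundaries from `K⁻¹` by the cocone condition, and those from
    -- `L⁻²` because it factors through `Y` on `L⁻¹`.
    obtain ⟨g', hg'⟩ := r.exists_desc g (hext'
      (by
        rw [← Category.assoc, hinl_d, Preadditive.sub_comp, Category.assoc, Category.assoc, hg₁,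
          hg₂, ← reassoc_of% hφ', s.condition, ← (resolution X).fac, Category.assoc,
          reassoc_of% (resolution_i_comp X), sub_self, comp_zero])
      (by
        rw [← Category.assoc, hinr_d, Category.assoc, hg₂, Resolution.d_p_assoc, comp_zero]))
    refine ⟨g', ?_, ?_⟩
    · rw [← cancel_epi (resolution Y).p, reassoc_of% hv', hg', hg₂]
    · rw [Category.assoc, Category.assoc, hg', hg₁, Iso.inv_hom_id_assoc]
  refine ⟨ObjectProperty.homMk v, (resolutionIso X).inv ≫ inl ≫ r.p, ObjectProperty.homMk w,
    ⟨⟨comm⟩, ⟨PushoutCocone.IsColimit.mk _ (fun s => (exists_desc s).choose)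
      (fun s => (exists_desc s).choose_spec.1) (fun s => (exists_desc s).choose_spec.2)
      (fun s _ h₁ h₂ => hom_ext (h₁.trans (exists_desc s).choose_spec.1.symm)
        (h₂.trans (exists_desc s).choose_spec.2.symm))⟩⟩, ?_, ?_, hv, hw⟩
  · ext
    change v ≫ w = 0
    rw [← cancel_epi (resolution Y).p, reassoc_of% hv', hw₂, comp_zero]
  · change ((resolutionIso X).inv ≫ inl ≫ r.p) ≫ w = _
    rw [Category.assoc, Category.assoc, hw₁, Iso.inv_hom_id_assoc]

end Cone

end StableTriangulated

/-! ### Comparison of standard triangles with mapping cone triangles -/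

section StandardTriangles

attribute [local instance] stableShift stableShift_additive stablePretriangulated
  stable_isTriangulated

variable {C : Type u} [Category.{v} C] [Abelian C]

/-- A standard triangle as a triangle of the stable category. -/
abbrev StandardTriangle.triangle (S : StandardTriangle C) : Triangle (StableGP C) :=
  Triangle.mk ((toStable C).map S.u) ((toStable C).map S.v)
    (S.connecting ≫ (stableShiftIso C).inv.app _)

/-- The chosen resolution of `Σ X` cancels out against the shift comparison, so that the connecting
morphism can be compared with that of a mapping cone. -/
lemma map_connecting_comp (S : StandardTriangle C) :
    (toHomotopy C).map (S.connecting ≫ (stableShiftIso C).inv.app ((toStable C).obj S.X)) ≫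
      ((toHomotopy C).commShiftIso (1 : ℤ)).hom.app ((toStable C).obj S.X) =
    (resolution S.Z).hmap (suspensionResolution S.X) S.w.hom ≫
      ((HomotopyCategory.quotient C (ComplexShape.up ℤ)).commShiftIso (1 : ℤ)).hom.app
        (resolution S.X).K := by
  rw [Functor.map_comp, Category.assoc, map_stableShiftIso_inv]
  have h : (resolution S.Z).hmap (suspensionResolution S.X) S.w.hom =
      (resolution S.Z).hmap (resolution (cosyzygy S.X).obj) S.w.hom ≫
      (resolution (cosyzygy S.X).obj).hmap (suspensionResolution S.X) (𝟙 _) := by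
    rw [Resolution.hmap_comp, Category.comp_id]
  exact ((congrArg (· ≫ ((HomotopyCategory.quotient C (ComplexShape.up ℤ)).commShiftIso
    (1 : ℤ)).hom.app (resolution S.X).K) h).trans (Category.assoc _ _ _)).symm

/-- The pushout is realized as the object resolved by the mapping cone of a lift of `u`. The
triangle then differs from the cone triangle only by the comparison of two resolutions of the same
object. -/
lemma exists_standardTriangle {X Y : GP C} (u : X ⟶ Y) :
    ∃ (Z : GP C) (v : Y ⟶ Z) (k : (cosyzygy X).P ⟶ Z.obj) (w : Z ⟶ (cosyzygy X).obj)
      (h₁ : IsPushout u.hom (cosyzygy X).ι v.hom k) (h₂ : v ≫ w = 0)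
      (h₃ : k ≫ w.hom = (cosyzygy X).π),
      (StandardTriangle.mk X Y Z u v k w h₁ h₂ h₃).triangle ∈ distTriang (StableGP C) := by
  obtain ⟨φ, hφ⟩ := (resolution X).exists_covers (resolution Y) u.hom
  obtain ⟨v, k, w, h₁, h₂, h₃, hv, hw⟩ := exists_isPushout_cone hφ
  refine ⟨coneObj φ, v, k, w, h₁, h₂, h₃, ?_⟩
  let S := StandardTriangle.mk X Y _ u v k w h₁ h₂ h₃
  let e := (resolution (coneObj φ)).hiso (coneResolution φ) (Iso.refl _)
  refine isomorphic_distinguished _ (HomotopyCategory.mappingCone_triangleh_distinguished φ) _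
    (triangleMkIso (f := (toHomotopy C).map ((toStable C).map u))
      (g := (toHomotopy C).map ((toStable C).map v))
      (h := (toHomotopy C).map (S.connecting ≫
        (stableShiftIso C).inv.app ((toStable C).obj X)) ≫
        ((toHomotopy C).commShiftIso (1 : ℤ)).hom.app ((toStable C).obj X))
      (f' := (HomotopyCategory.quotient _ _).map φ)
      (g' := (HomotopyCategory.quotient _ _).map (CochainComplex.mappingCone.inr φ))
      (h' := (HomotopyCategory.quotient _ _).map (CochainComplex.mappingCone.triangle φ).mor₃ ≫
        ((HomotopyCategory.quotient C (ComplexShape.up ℤ)).commShiftIso (1 : ℤ)).hom.app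
          (resolution X).K) (Iso.refl _) (Iso.refl _) e ?_ ?_ ?_)
  · exact (Category.comp_id _).trans (hφ.hmap_eq.trans (Category.id_comp _).symm)
  · refine Eq.trans ?_ (Category.id_comp _).symm
    refine ((resolution Y).hmap_comp (resolution (coneObj φ)) (coneResolution φ) v.hom
      (𝟙 _)).trans ?_
    exact (congrArg ((resolution Y).hmap (coneResolution φ)) (Category.comp_id _)).trans hv.hmap_eq
  · have h₄ : (resolution (coneObj φ)).hmap (suspensionResolution X) w.hom =
        (resolution (coneObj φ)).hmap (coneResolution φ) (𝟙 _) ≫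
          (coneResolution φ).hmap (suspensionResolution X) w.hom :=
      ((congrArg ((resolution (coneObj φ)).hmap (suspensionResolution X))
        (Category.id_comp w.hom)).symm).trans
        ((resolution (coneObj φ)).hmap_comp (coneResolution φ) (suspensionResolution X)
          (𝟙 _) w.hom).symm
    rw [hw.hmap_eq] at h₄
    refine (congrArg (_ ≫ ·) (CategoryTheory.Functor.map_id _ _)).trans
      ((Category.comp_id _).trans ((map_connecting_comp S).trans ?_))
    exact (congrArg (· ≫ ((HomotopyCategory.quotient C (ComplexShape.up ℤ)).commShiftIso
      (1 : ℤ)).hom.app (resolution X).K) h₄).trans (Category.assoc _ _ _)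

/-- Pushouts are unique, and `w` is determined by its restrictions to `Y` and `P(X)`; hence one
distinguished standard triangle on `u` suffices. -/
lemma StandardTriangle.triangle_distinguished (S : StandardTriangle C) :
    S.triangle ∈ distTriang (StableGP C) := by
  obtain ⟨Z, v, k, w, h₁, h₂, h₃, mem⟩ := exists_standardTriangle S.u
  let e : S.Z.obj ≅ Z.obj := S.isPushout.isoIsPushout _ _ h₁
  have he₁ : S.v.hom ≫ e.hom = v.hom := IsPushout.inl_isoIsPushout_hom _ _ S.isPushout h₁
  have he₂ : S.k ≫ e.hom = k := IsPushout.inr_isoIsPushout_hom _ _ S.isPushout h₁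
  let e' : S.Z ≅ Z := (GProj C).isoMk e
  have he' : S.w = e'.hom ≫ w := by
    ext
    change S.w.hom = e.hom ≫ w.hom
    refine S.isPushout.hom_ext ?_ ?_
    · have h₄ : S.v.hom ≫ S.w.hom = 0 := congrArg (·.hom) S.v_w
      have h₅ : v.hom ≫ w.hom = 0 := congrArg (·.hom) h₂
      rw [reassoc_of% he₁, h₄, h₅]
    · rw [reassoc_of% he₂, h₃, S.k_w]
  refine isomorphic_distinguished _ mem _ (triangleMkIso (Iso.refl _) (Iso.refl _)
    ((toStable C).mapIso e') ?_ ?_ ?_)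
  · exact (Category.comp_id _).trans (Category.id_comp _).symm
  · refine Eq.trans ?_ (Category.id_comp _).symm
    refine ((toStable C).map_comp _ _).symm.trans (congrArg (toStable C).map ?_)
    ext
    exact he₁
  · refine (congrArg (_ ≫ ·) (CategoryTheory.Functor.map_id _ _)).trans
      ((Category.comp_id _).trans ?_)
    refine Eq.trans ?_ (Category.assoc _ _ _)
    refine congrArg (· ≫ (stableShiftIso C).inv.app ((toStable C).obj S.X)) ?_
    exact (congrArg (toStable C).map he').trans ((toStable C).map_comp _ _)

variable (C) in
/-- The triangulated structure of the stable category of Gorenstein projective objects. -/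
@[reducible]
def stableTriangulation : StableTriangulation C where
  shift := stableShift C
  shift_additive := stableShift_additive C
  pretriangulated := stablePretriangulated C
  triangulated := stable_isTriangulated C
  shiftIso := stableShiftIso C
  distinguished_iff T := by
    constructor
    · intro hT
      -- Two distinguished triangles with the same first morphism are isomorphic, so it suffices to
      -- represent this morphism by some `u`.
      obtain ⟨u, hu⟩ := (toStable C).map_surjective (X := T.obj₁.as) (Y := T.obj₂.as) T.mor₁
      obtain ⟨Z, v, k, w, h₁, h₂, h₃, mem⟩ := exists_standardTriangle u
      exact ⟨_, ⟨isoTriangleOfIso₁₂ T _ hT mem (Iso.refl _) (Iso.refl _)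
        ((Category.comp_id _).trans (hu.symm.trans (Category.id_comp _).symm))⟩⟩
    · rintro ⟨S, ⟨e⟩⟩
      exact isomorphic_distinguished _ S.triangle_distinguished _ e

/-! ### Triangles attached to short exact sequences -/

/-- Extensions of Gorenstein projective objects by projective objects split. -/
lemma exists_section {Z : C} (hZ : GProj C Z) {S : ShortComplex C} (hS : S.ShortExact)
    (hP : Projective S.X₁) (e : Z ⟶ S.X₃) : ∃ s : Z ⟶ S.X₂, s ≫ S.g = e := by
  obtain ⟨r⟩ := Resolution.exists_of_gproj hZ
  have := hS.epi_g
  have := hS.mono_f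
  have := r.complete.projective (-1)
  have ha := Projective.factorThru_comp (r.p ≫ e) S.g
  set a := Projective.factorThru (r.p ≫ e) S.g
  -- The obstruction to descending `a` to `Z` takes values in the projective kernel `S.X₁`. There it
  -- is a cocycle, hence a coboundary, and `a` can be corrected; this is the vanishing of `Ext¹(Z,
  -- P)`.
  obtain ⟨b, hb⟩ : ∃ b, b ≫ S.f = r.K.d (-2) (-1) ≫ a :=
    ⟨hS.exact.lift _ (by rw [Category.assoc, ha, Resolution.d_p_assoc]), hS.exact.lift_f _ _⟩
  obtain ⟨c, hc⟩ := r.complete.homExact _ hP (-3) (-2) (-1) (by lia) (by lia) b (by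
    rw [← cancel_mono S.f, Category.assoc, hb]
    simp)
  obtain ⟨s, hs⟩ := r.exists_desc (a - c ≫ S.f) (by
    rw [Preadditive.comp_sub, reassoc_of% hc, hb, sub_self])
  refine ⟨s, ?_⟩
  rw [← cancel_epi r.p, reassoc_of% hs]
  simp [ha]

/-- A short exact sequence of Gorenstein projective objects is part of a distinguished
triangle. -/
lemma exists_distinguished_of_shortExact {X Y Z : GP C} (f : X ⟶ Y) (g : Y ⟶ Z)
    (zero : f.hom ≫ g.hom = 0) (hS : (ShortComplex.mk f.hom g.hom zero).ShortExact) :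
    ∃ h : (toStable C).obj Z ⟶ ((toStable C).obj X)⟦(1 : ℤ)⟧,
      Triangle.mk ((toStable C).map f) ((toStable C).map g) h ∈ distTriang (StableGP C) := by
  obtain ⟨W, v, k, w, h₁, h₂, h₃, mem⟩ := exists_standardTriangle f
  have : Mono f.hom := hS.mono_f
  have : Epi g.hom := hS.epi_g
  have := (cosyzygy X).projective
  have : Mono k := Abelian.mono_inr_of_isColimit _ _ h₁.isColimit
  -- The pushout sits in `0 ⟶ P(X) ⟶ W ⟶ Z ⟶ 0`. This sequence splits by `exists_section`, so `q` is
  -- invertible in the stable category and `Z` may replace `W`.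
  let q : W.obj ⟶ Z.obj := h₁.desc g.hom 0 (by rw [zero, comp_zero])
  have hq₁ : v.hom ≫ q = g.hom := h₁.inl_desc _ _ _
  have hq₂ : k ≫ q = 0 := h₁.inr_desc _ _ _
  have : Epi q := epi_of_epi_fac hq₁
  have hS' : (ShortComplex.mk k q hq₂).ShortExact := by
    refine ShortComplex.ShortExact.mk (ShortComplex.exact_of_g_is_cokernel _
      (CokernelCofork.IsColimit.ofπ' _ _ (fun {T} m hm => ?_)))
    have hm' : f.hom ≫ v.hom ≫ m = 0 := by
      have hm'' : k ≫ m = 0 := hm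
      rw [reassoc_of% h₁.w, hm'', comp_zero]
    refine ⟨hS.exact.desc (v.hom ≫ m) hm', h₁.hom_ext ?_ ?_⟩
    · rw [reassoc_of% hq₁]
      exact hS.exact.g_desc _ _
    · rw [reassoc_of% hq₂, zero_comp]
      exact hm.symm
  obtain ⟨s, hs⟩ := exists_section Z.property hS' (cosyzygy X).projective (𝟙 _)
  change s ≫ q = 𝟙 _ at hs
  obtain ⟨t, ht⟩ : ∃ t, t ≫ k = 𝟙 _ - q ≫ s :=
    ⟨hS'.exact.lift _ (by simp [hs]), hS'.exact.lift_f _ _⟩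
  let q' : W ⟶ Z := ObjectProperty.homMk q
  let s' : Z ⟶ W := ObjectProperty.homMk s
  let e : (toStable C).obj Z ≅ (toStable C).obj W :=
    { hom := (toStable C).map s'
      inv := (toStable C).map q'
      hom_inv_id := by
        rw [← Functor.map_comp, ← (toStable C).map_id]
        congr 1
        ext
        exact hs
      inv_hom_id := by
        rw [← Functor.map_comp, ← (toStable C).map_id]
        exact (CategoryTheory.Quotient.sound _ ⟨_, t, k, (cosyzygy X).projective, ht.symm⟩).symm }
  have hg : (toStable C).map g = (toStable C).map v ≫ e.inv := by
    change _ = (toStable C).map v ≫ (toStable C).map q'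
    rw [← Functor.map_comp]
    congr 1
    ext
    exact hq₁.symm
  rw [hg]
  exact ⟨_, distinguished_of_iso₃ mem e⟩

end StandardTriangles

section InducedFunctors

attribute [local instance] stableShift stableShift_additive stablePretriangulated
  stable_isTriangulated

variable {C : Type u₁} [Category.{v₁} C] [Abelian C] {D : Type u₂} [Category.{v₂} D] [Abelian D]

/-! ### Functors that preserve complete resolutions -/

/-- The functor `L` preserves projective objects and complete projective resolutions. -/
structure PreservesCompleteResolutions (L : C ⥤ D) [L.Additive] : Prop where
  projective : ∀ P : C, Projective P → Projective (L.obj P)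
  complete : ∀ K : CochainComplex C ℤ, IsCompleteResolution K →
    IsCompleteResolution ((L.mapHomologicalComplex (ComplexShape.up ℤ)).obj K)

namespace PreservesCompleteResolutions

variable {L : C ⥤ D} [L.Additive] [L.PreservesEpimorphisms]

/-- No left exactness of `L` is needed: an element killed by `L.map r.i` lifts along `L.map r.p` to
a cycle of the exact complex `L K`, so the lift is a boundary and dies under `L.map r.p`. -/
lemma mono_map_i (hL : PreservesCompleteResolutions L) {X : C} (r : Resolution X) :
    Mono (L.map r.i) := by
  have := r.epi_p
  have hd : L.map r.p ≫ L.map r.i = L.map (r.K.d (-1) 0) := by rw [← L.map_comp, r.fac]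
  have hd' : L.map (r.K.d (-2) (-1)) ≫ L.map r.p = 0 := by
    rw [← L.map_comp, r.d_p, L.map_zero]
  rw [Preadditive.mono_iff_cancel_zero]
  intro T x hx
  obtain ⟨T', π, hπ, y, hy⟩ := surjective_up_to_refinements_of_epi (L.map r.p) x
  obtain ⟨T'', π', hπ', z, hz⟩ : ∃ (T'' : D) (π' : T'' ⟶ T') (_ : Epi π')
      (z : T'' ⟶ L.obj (r.K.X (-2))), π' ≫ y = z ≫ L.map (r.K.d (-2) (-1)) :=
    exists_refinement (hL.complete _ r.complete).acyclic (-2) (-1) 0 (by lia)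
      (by lia) y (by
        change y ≫ L.map (r.K.d (-1) 0) = 0
        rw [← hd, ← reassoc_of% hy, hx, comp_zero])
  rw [← cancel_epi π, ← cancel_epi π', comp_zero, comp_zero, hy, reassoc_of% hz, hd', comp_zero]

lemma epi_map_p (_hL : PreservesCompleteResolutions L) {X : C} (r : Resolution X) :
    Epi (L.map r.p) := by
  have := r.epi_p
  infer_instance

/-- The image of a resolution under a functor that preserves complete resolutions. -/
def mapResolution (hL : PreservesCompleteResolutions L) {X : C} (r : Resolution X) :
    Resolution (L.obj X) where
  K := (L.mapHomologicalComplex (ComplexShape.up ℤ)).obj r.K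
  complete := hL.complete _ r.complete
  p := L.map r.p
  i := L.map r.i
  epi_p := hL.epi_map_p r
  mono_i := hL.mono_map_i r
  fac := (L.map_comp r.p r.i).symm.trans (congrArg L.map r.fac)

lemma preservesGP (hL : PreservesCompleteResolutions L) : PreservesGP L where
  gproj X hX := by
    obtain ⟨r⟩ := Resolution.exists_of_gproj hX
    exact (hL.mapResolution r).gproj
  projective := hL.projective

lemma mapHomotopyCategory_map_hmap (hL : PreservesCompleteResolutions L) {X Y : C}
    (r : Resolution X) (s : Resolution Y) (f : X ⟶ Y) :
    (L.mapHomotopyCategory (ComplexShape.up ℤ)).map (r.hmap s f) =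
      (hL.mapResolution r).hmap (hL.mapResolution s) (L.map f) := by
  obtain ⟨φ, hφ⟩ := r.exists_covers s f
  have h : (hL.mapResolution r).Covers (hL.mapResolution s) (L.map f)
      ((L.mapHomologicalComplex (ComplexShape.up ℤ)).map φ) :=
    (L.map_comp _ _).symm.trans ((congrArg L.map hφ).trans (L.map_comp _ _))
  rw [h.hmap_eq, hφ.hmap_eq]
  rfl

/-- The embedding into the homotopy category is compatible with functors that preserve
complete resolutions. -/
def stableMapToHomotopyIso (hL : PreservesCompleteResolutions L) :
    stableMap L hL.preservesGP ⋙ toHomotopy D ≅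
      toHomotopy C ⋙ L.mapHomotopyCategory (ComplexShape.up ℤ) :=
  NatIso.ofComponents (fun X =>
    (resolution ((GProj D).lift ((GProj C).ι ⋙ L)
      (fun X => hL.preservesGP.gproj _ X.property) |>.obj X.as)).hiso
      (hL.mapResolution (resolution X.as)) (Iso.refl _)) (by
    intro X Y f
    obtain ⟨f, rfl⟩ := (toStable C).map_surjective f
    refine Eq.trans (Resolution.hmap_comp _ _ _ (L.map f.hom) (𝟙 _)) ?_
    refine Eq.trans ?_ (congrArg (_ ≫ ·) (hL.mapHomotopyCategory_map_hmap _ _ f.hom)).symm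
    refine Eq.trans ?_ (Resolution.hmap_comp
      (resolution (⟨L.obj X.as.obj, hL.preservesGP.gproj _ X.as.property⟩ : GP D))
      (hL.mapResolution (resolution X.as)) (hL.mapResolution (resolution Y.as))
      (𝟙 (L.obj X.as.obj)) (L.map f.hom)).symm
    exact congrArg _ ((Category.comp_id _).trans (Category.id_comp _).symm))

/-- The functor induced on stable categories commutes with the shifts. -/
@[reducible]
def stableMapCommShift (hL : PreservesCompleteResolutions L) :
    (stableMap L hL.preservesGP).CommShift ℤ :=
  Functor.CommShift.ofComp hL.stableMapToHomotopyIso ℤ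

/-- Exactness can be tested after the embedding into the homotopy category, where the functor
becomes the termwise action of `L`, which is triangulated. -/
lemma stableMap_isTriangulated (hL : PreservesCompleteResolutions L) :
    letI := hL.stableMapCommShift
    (stableMap L hL.preservesGP).IsTriangulated := by
  let := hL.stableMapCommShift
  have := Functor.CommShift.ofComp_compatibility hL.stableMapToHomotopyIso ℤ
  rw [Functor.isTriangulated_iff_comp_right hL.stableMapToHomotopyIso]
  infer_instance

end PreservesCompleteResolutions

/-! ### Adjunctions on stable categories -/

section Adjunction

variable {L : C ⥤ D} {R : D ⥤ C} [L.Additive] [R.Additive] (adj : L ⊣ R) (hL : PreservesGP L)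
  (hR : PreservesGP R)

/-- The adjunction induced on stable categories. -/
def stableAdjunction : stableMap L hL ⊣ stableMap R hR :=
  Adjunction.mkOfUnitCounit
    { unit := CategoryTheory.Quotient.natTransLift _
        { app := fun X => (toStable C).map (X := X)
            (Y := ⟨R.obj (L.obj X.obj), hR.gproj _ (hL.gproj _ X.property)⟩)
            (ObjectProperty.homMk (adj.unit.app X.obj))
          naturality := fun X Y f => by
            refine ((toStable C).map_comp _ _).symm.trans (Eq.trans ?_ ((toStable C).map_comp _ _))
            congr 1
            ext
            exact adj.unit.naturality f.hom }
      counit := CategoryTheory.Quotient.natTransLift _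
        { app := fun X => (toStable D).map
            (X := ⟨L.obj (R.obj X.obj), hL.gproj _ (hR.gproj _ X.property)⟩) (Y := X)
            (ObjectProperty.homMk (adj.counit.app X.obj))
          naturality := fun X Y f => by
            refine ((toStable D).map_comp _ _).symm.trans (Eq.trans ?_ ((toStable D).map_comp _ _))
            congr 1
            ext
            exact adj.counit.naturality f.hom }
      left_triangle := by
        ext X
        refine (congrArg (_ ≫ ·) (Category.id_comp _)).trans
          (((toStable D).map_comp _ _).symm.trans (Eq.trans ?_ ((toStable D).map_id _)))
        congr 1
        ext
        exact adj.left_triangle_components X.as.obj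
      right_triangle := by
        ext X
        refine (congrArg (_ ≫ ·) (Category.id_comp _)).trans
          (((toStable C).map_comp _ _).symm.trans (Eq.trans ?_ ((toStable C).map_id _)))
        congr 1
        ext
        exact adj.right_triangle_components X.as.obj }

instance [IsIso adj.unit] : IsIso (stableAdjunction adj hL hR).unit := by
  have (X : StableGP C) : IsIso ((stableAdjunction adj hL hR).unit.app X) := by
    let e : X.as ≅ (⟨R.obj (L.obj X.as.obj), hR.gproj _ (hL.gproj _ X.as.property)⟩ : GP C) :=
      (GProj C).isoMk (asIso (adj.unit.app X.as.obj))
    exact ((toStable C).mapIso e).isIso_hom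
  exact NatIso.isIso_of_isIso_app _

instance [IsIso adj.counit] : IsIso (stableAdjunction adj hL hR).counit := by
  have (X : StableGP D) : IsIso ((stableAdjunction adj hL hR).counit.app X) := by
    let e : (⟨L.obj (R.obj X.as.obj), hL.gproj _ (hR.gproj _ X.as.property)⟩ : GP D) ≅ X.as :=
      (GProj D).isoMk (asIso (adj.counit.app X.as.obj))
    exact ((toStable D).mapIso e).isIso_hom
  exact NatIso.isIso_of_isIso_app _

end Adjunction

end InducedFunctors

section CommaCategory

variable {A : Type u₁} [Category.{v₁} A] {B : Type u₂} [Category.{v₂} B] {F : A ⥤ B}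

/-! ### Objects and morphisms of the left comma category -/

/-- The morphism `F Y ⟶ X` of an object `(Y, X)` of the left comma category. -/
def structureMap (M : LeftComma F) : F.obj M.left ⟶ M.right := M.hom

lemma structureMap_comm {M N : LeftComma F} (f : M ⟶ N) :
    F.map f.left ≫ structureMap N = structureMap M ≫ f.right := f.w

/-- The object of the left comma category given by a morphism `F Y ⟶ X`. -/
def commaObj {Y : A} {X : B} (φ : F.obj Y ⟶ X) : LeftComma F where
  left := Y
  right := X
  hom := φ

/-- The morphism of the left comma category given by a commutative square. -/
def commaHom {M N : LeftComma F} (a : M.left ⟶ N.left) (b : M.right ⟶ N.right)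
    (w : F.map a ≫ structureMap N = structureMap M ≫ b) : M ⟶ N where
  left := a
  right := b
  w := w

lemma comma_epi_of_epi {M N : LeftComma F} (f : M ⟶ N) [Epi f.left] [Epi f.right] : Epi f where
  left_cancellation g h w := by
    ext
    · rw [← cancel_epi f.left]
      exact congrArg CommaMorphism.left w
    · rw [← cancel_epi f.right]
      exact congrArg CommaMorphism.right w

lemma comma_mono_of_mono {M N : LeftComma F} (f : M ⟶ N) [Mono f.left] [Mono f.right] :
    Mono f where
  right_cancellation g h w := by
    ext
    · rw [← cancel_mono f.left]
      exact congrArg CommaMorphism.left w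
    · rw [← cancel_mono f.right]
      exact congrArg CommaMorphism.right w

variable [Abelian B]

/-- The projection from `X` to the cokernel of `F Y ⟶ X`. -/
def cokerπ (M : LeftComma F) : M.right ⟶ (cokerFunctor F).obj M := cokernel.π M.hom

instance (M : LeftComma F) : Epi (cokerπ M) := inferInstanceAs (Epi (cokernel.π M.hom))

lemma structureMap_cokerπ (M : LeftComma F) : structureMap M ≫ cokerπ M = 0 :=
  cokernel.condition M.hom

lemma exact_structureMap_cokerπ (M : LeftComma F) :
    (ShortComplex.mk _ _ (structureMap_cokerπ M)).Exact :=
  ShortComplex.exact_cokernel M.hom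

lemma exists_coker_desc {M : LeftComma F} {Z : B} (f : M.right ⟶ Z)
    (hf : structureMap M ≫ f = 0) : ∃ g, cokerπ M ≫ g = f :=
  ⟨cokernel.desc M.hom f hf, cokernel.π_desc M.hom f hf⟩

lemma cokerπ_naturality {M N : LeftComma F} (f : M ⟶ N) :
    cokerπ M ≫ (cokerFunctor F).map f = f.right ≫ cokerπ N :=
  cokernel.π_desc _ _ _

/-! ### Projective objects of the left comma category -/

/-- A lifting problem in `A` is the same as one in the comma category between objects with second
component zero. -/
lemma projective_left {M : LeftComma F} (hM : Projective M) : Projective M.left where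
  factors {E X} f e he := by
    let N (Y : A) : LeftComma F := commaObj (0 : F.obj Y ⟶ 0)
    let e' : N E ⟶ N X := commaHom (M := N E) (N := N X) e 0 (comp_zero.trans comp_zero.symm)
    let f' : M ⟶ N X := commaHom (N := N X) f 0 (comp_zero.trans comp_zero.symm)
    have : Epi e'.left := he
    have : Epi e'.right := ⟨fun _ _ _ => (isZero_zero B).eq_of_src _ _⟩
    have := comma_epi_of_epi e'
    exact ⟨(Projective.factorThru f' e').left,
      congrArg CommaMorphism.left (Projective.factorThru_comp f' e')⟩

/-- The morphism `F Y ⟶ X` of a projective object is a split monomorphism. -/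
lemma exists_retraction {M : LeftComma F} (hM : Projective M) :
    ∃ ρ : M.right ⟶ F.obj M.left, structureMap M ≫ ρ = 𝟙 _ := by
  -- The object `(Y, F Y ⊕ X)` maps onto `(Y, X)` by the identity on `Y`. A splitting has second
  -- component `t` with `φ ≫ t` equal to the inclusion of `F Y`, so projecting `t` to `F Y` gives
  -- the retraction.
  let N : LeftComma F := commaObj (biprod.inl : F.obj M.left ⟶ F.obj M.left ⊞ M.right)
  let b : F.obj M.left ⊞ M.right ⟶ M.right := biprod.desc (structureMap M) (𝟙 _)
  let e : N ⟶ M := commaHom (M := N) (𝟙 M.left) b (by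
    change F.map (𝟙 M.left) ≫ structureMap M = biprod.inl ≫ biprod.desc (structureMap M) (𝟙 _)
    rw [F.map_id, Category.id_comp, biprod.inl_desc])
  have : Epi e.left := inferInstanceAs (Epi (𝟙 M.left))
  have : Epi e.right := (SplitEpi.mk (f := b) biprod.inr (biprod.inr_desc _ _)).epi
  have := comma_epi_of_epi e
  let s := Projective.factorThru (𝟙 M) e
  have hs : s.left = 𝟙 M.left := (Category.comp_id _).symm.trans
    (congrArg CommaMorphism.left (Projective.factorThru_comp (𝟙 M) e))
  let t : M.right ⟶ F.obj M.left ⊞ M.right := s.right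
  have ht : F.map (𝟙 M.left) ≫ biprod.inl = structureMap M ≫ t :=
    (congrArg (F.map · ≫ structureMap N) hs).symm.trans (structureMap_comm s)
  exact ⟨t ≫ biprod.fst, by
    rw [← Category.assoc, ← ht, F.map_id, Category.id_comp, biprod.inl_fst]⟩

lemma mono_structureMap {M : LeftComma F} (hM : Projective M) : Mono (structureMap M) := by
  obtain ⟨ρ, hρ⟩ := exists_retraction hM
  exact mono_of_mono_fac hρ

/-! ### The adjunctions -/

/-- The morphism `(Y, F Y) ⟶ (Y, X)` given by the identity of `Y`. -/
def freeCounit (M : LeftComma F) : (freeFunctor F).obj M.left ⟶ M where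
  left := 𝟙 M.left
  right := structureMap M
  w := by
    change F.map (𝟙 M.left) ≫ structureMap M = 𝟙 (F.obj M.left) ≫ structureMap M
    rw [F.map_id]

variable (F) in
/-- The functor `Y ↦ (Y, F Y)` is left adjoint to `(Y, X) ↦ Y`. -/
def freeAdjunction : freeFunctor F ⊣ leftFunctor F :=
  Adjunction.mkOfUnitCounit
    { unit :=
        { app := fun Y => 𝟙 Y
          naturality := fun Y Y' f =>
            ((Category.comp_id f).trans (Category.id_comp f).symm : f ≫ 𝟙 Y' = 𝟙 Y ≫ f) }
      counit :=
        { app := fun M => freeCounit M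
          naturality := fun M N f => by
            ext
            · exact ((Category.comp_id f.left).trans (Category.id_comp f.left).symm)
            · exact structureMap_comm f }
      left_triangle := by
        ext Y
        · change 𝟙 Y ≫ 𝟙 Y ≫ 𝟙 Y = 𝟙 Y
          simp
        · change F.map (𝟙 Y) ≫ 𝟙 (F.obj Y) ≫ 𝟙 (F.obj Y) = 𝟙 (F.obj Y)
          simp
      right_triangle := by
        ext M
        change 𝟙 M.left ≫ 𝟙 M.left ≫ 𝟙 M.left = 𝟙 M.left
        simp }

instance : IsIso (freeAdjunction F).unit := by
  have (Y : A) : IsIso ((freeAdjunction F).unit.app Y) := inferInstanceAs (IsIso (𝟙 Y))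
  exact NatIso.isIso_of_isIso_app _

variable [Abelian A] [F.Additive]

variable (F) in
lemma isZero_zeroLeft_left (X : B) : IsZero ((zeroLeft F).obj X).left := isZero_zero A

/-- The projection `(Y, X) ⟶ (0, Coker φ)`. -/
def cokerUnit (M : LeftComma F) : M ⟶ (zeroLeft F).obj ((cokerFunctor F).obj M) where
  left := 0
  right := cokerπ M
  w := (Eq.trans (by rw [F.map_zero, zero_comp]) (structureMap_cokerπ M).symm :
    F.map (0 : M.left ⟶ 0) ≫ (0 : F.obj 0 ⟶ (cokerFunctor F).obj M) = _)

variable (F) in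
/-- The cokernel of `F 0 ⟶ X` is `X`. -/
def cokerCounit (X : B) : (cokerFunctor F).obj ((zeroLeft F).obj X) ⟶ X :=
  cokernel.desc (0 : F.obj 0 ⟶ X) (𝟙 X) zero_comp

variable (F) in
/-- The inverse of `cokerCounit`. -/
def cokerZeroLeftπ (X : B) : X ⟶ (cokerFunctor F).obj ((zeroLeft F).obj X) :=
  cokerπ ((zeroLeft F).obj X)

instance (X : B) : Epi (cokerZeroLeftπ F X) := inferInstanceAs (Epi (cokerπ _))

variable (F) in
lemma cokerZeroLeftπ_cokerCounit (X : B) : cokerZeroLeftπ F X ≫ cokerCounit F X = 𝟙 X :=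
  cokernel.π_desc _ _ _

lemma cokerπ_map_to_zeroLeft {M : LeftComma F} {X : B} (f : M ⟶ (zeroLeft F).obj X)
    (g : M.right ⟶ X) (h : f.right = g) :
    cokerπ M ≫ (cokerFunctor F).map f = g ≫ cokerZeroLeftπ F X :=
  (cokerπ_naturality f).trans (congrArg (· ≫ cokerZeroLeftπ F X) h)

instance (X : B) : IsIso (cokerCounit F X) :=
  ⟨cokerZeroLeftπ F X, by
    rw [← cancel_epi (cokerZeroLeftπ F X), reassoc_of% (cokerZeroLeftπ_cokerCounit F X),
      Category.comp_id], cokerZeroLeftπ_cokerCounit F X⟩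

lemma cokerCounit_naturality {X Y : B} (f : X ⟶ Y) :
    (cokerFunctor F).map ((zeroLeft F).map f) ≫ cokerCounit F Y = cokerCounit F X ≫ f := by
  have h : cokerZeroLeftπ F X ≫ (cokerFunctor F).map ((zeroLeft F).map f) =
    f ≫ cokerZeroLeftπ F Y := cokerπ_map_to_zeroLeft _ _ rfl
  rw [← cancel_epi (cokerZeroLeftπ F X), reassoc_of% h,
    reassoc_of% (cokerZeroLeftπ_cokerCounit F X), cokerZeroLeftπ_cokerCounit, Category.comp_id]

lemma coker_left_triangle (M : LeftComma F) :
    (cokerFunctor F).map (cokerUnit M) ≫ cokerCounit F ((cokerFunctor F).obj M) = 𝟙 _ := by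
  have h : cokerπ M ≫ (cokerFunctor F).map (cokerUnit M) =
    cokerπ M ≫ cokerZeroLeftπ F ((cokerFunctor F).obj M) := cokerπ_map_to_zeroLeft _ _ rfl
  rw [← cancel_epi (cokerπ M), reassoc_of% h, cokerZeroLeftπ_cokerCounit]

variable (F) in
/-- The functor `(Y, X) ↦ Coker φ` is left adjoint to `X ↦ (0, X)`. -/
def cokerAdjunction : cokerFunctor F ⊣ zeroLeft F :=
  Adjunction.mkOfUnitCounit
    { unit :=
        { app := fun M => cokerUnit M
          naturality := fun M N f => by
            ext
            · exact (isZero_zeroLeft_left F _).eq_of_tgt _ _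
            · exact (cokerπ_naturality f).symm }
      counit :=
        { app := fun X => cokerCounit F X
          naturality := fun X Y f => cokerCounit_naturality f }
      left_triangle := by
        ext M
        exact (congrArg (_ ≫ ·) (Category.id_comp _)).trans (coker_left_triangle M)
      right_triangle := by
        ext X
        · exact (isZero_zeroLeft_left F _).eq_of_tgt _ _
        · exact (congrArg (cokerZeroLeftπ F X ≫ ·) (Category.id_comp _)).trans
            (cokerZeroLeftπ_cokerCounit F X) }

instance : IsIso (cokerAdjunction F).counit := by
  have (X : B) : IsIso ((cokerAdjunction F).counit.app X) :=
    inferInstanceAs (IsIso (cokerCounit F X))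
  exact NatIso.isIso_of_isIso_app _

/-- The inclusion `(0, X) ⟶ (Y, X)`. -/
def zeroLeftCounit (M : LeftComma F) : (zeroLeft F).obj M.right ⟶ M where
  left := 0
  right := 𝟙 M.right
  w := (by rw [F.map_zero, zero_comp, zero_comp] :
    F.map (0 : 0 ⟶ M.left) ≫ structureMap M = (0 : F.obj 0 ⟶ M.right) ≫ 𝟙 M.right)

variable (F) in
/-- The functor `X ↦ (0, X)` is left adjoint to `(Y, X) ↦ X`. -/
def zeroLeftAdjunction : zeroLeft F ⊣ Comma.snd F (𝟭 B) :=
  Adjunction.mkOfUnitCounit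
    { unit :=
        { app := fun X => 𝟙 X
          naturality := fun X Y f =>
            ((Category.comp_id f).trans (Category.id_comp f).symm : f ≫ 𝟙 Y = 𝟙 X ≫ f) }
      counit :=
        { app := fun M => zeroLeftCounit M
          naturality := fun M N f => by
            ext
            · exact (isZero_zeroLeft_left F _).eq_of_src _ _
            · exact (Category.comp_id f.right).trans (Category.id_comp f.right).symm }
      left_triangle := by
        ext X
        · exact (isZero_zeroLeft_left F _).eq_of_src _ _
        · change 𝟙 X ≫ 𝟙 X ≫ 𝟙 X = 𝟙 X
          simp
      right_triangle := by
        ext M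
        change 𝟙 M.right ≫ 𝟙 M.right ≫ 𝟙 M.right = 𝟙 M.right
        simp }

/-! ### Exactness -/

instance : (zeroLeft F).PreservesEpimorphisms :=
  Functor.preservesEpimorphisms_of_adjunction (zeroLeftAdjunction F)

instance : (freeFunctor F).PreservesEpimorphisms :=
  Functor.preservesEpimorphisms_of_adjunction (freeAdjunction F)

instance : (cokerFunctor F).PreservesEpimorphisms :=
  Functor.preservesEpimorphisms_of_adjunction (cokerAdjunction F)

lemma projective_coker {M : LeftComma F} (hM : Projective M) :
    Projective ((cokerFunctor F).obj M) :=
  (cokerAdjunction F).map_projective M hM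

lemma isZero_comma {M : LeftComma F} (h₁ : IsZero M.left) (h₂ : IsZero M.right) : IsZero M := by
  rw [IsZero.iff_id_eq_zero]
  ext
  · exact h₁.eq_of_src _ _
  · exact h₂.eq_of_src _ _

variable [PreservesFiniteColimits F]

variable (F) in
/-- The functor `(Y, X) ↦ X`. -/
abbrev rightFunctor : LeftComma F ⥤ B := Comma.snd F (𝟭 B)

instance : PreservesFiniteLimits (leftFunctor F) where
  preservesFiniteLimits _ _ _ := inferInstance

instance : PreservesFiniteLimits (rightFunctor F) where
  preservesFiniteLimits _ _ _ := inferInstance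

instance : PreservesFiniteColimits (leftFunctor F) where
  preservesFiniteColimits _ _ _ := inferInstance

instance : PreservesFiniteColimits (rightFunctor F) where
  preservesFiniteColimits _ _ _ := inferInstance

/-- Both projections are exact functors, so homology is computed componentwise, and an object with
zero components is zero. -/
lemma comma_exact {S : ShortComplex (LeftComma F)} (h₁ : (S.map (leftFunctor F)).Exact)
    (h₂ : (S.map (rightFunctor F)).Exact) : S.Exact := by
  rw [ShortComplex.exact_iff_isZero_homology] at h₁ h₂ ⊢
  exact isZero_comma (h₁.of_iso (S.mapHomologyIso (leftFunctor F)).symm)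
    (h₂.of_iso (S.mapHomologyIso (rightFunctor F)).symm)

lemma acyclic_map {C : Type u₁} [Category.{v₁} C] [Abelian C] {D : Type u₂} [Category.{v₂} D]
    [Abelian D] (L : C ⥤ D) [L.Additive] [PreservesFiniteLimits L] [PreservesFiniteColimits L]
    {K : CochainComplex C ℤ} (hK : K.Acyclic) :
    ((L.mapHomologicalComplex (ComplexShape.up ℤ)).obj K).Acyclic :=
  fun n => (hK n).map L

lemma comma_acyclic {K : CochainComplex (LeftComma F) ℤ}
    (h₁ : (((leftFunctor F).mapHomologicalComplex (ComplexShape.up ℤ)).obj K).Acyclic)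
    (h₂ : (((rightFunctor F).mapHomologicalComplex (ComplexShape.up ℤ)).obj K).Acyclic) :
    K.Acyclic :=
  fun n => comma_exact (h₁ n) (h₂ n)

lemma projective_zeroLeft {X : B} (hX : Projective X) : Projective ((zeroLeft F).obj X) :=
  (zeroLeftAdjunction F).map_projective X hX

lemma projective_free {Y : A} (hY : Projective Y) : Projective ((freeFunctor F).obj Y) :=
  (freeAdjunction F).map_projective Y hY

end CommaCategory

section HomExactness

variable {C : Type u₁} [Category.{v₁} C] [Abelian C] {D : Type u₂} [Category.{v₂} D] [Abelian D]

/-! ### The functors of the recollement preserve complete resolutions -/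

/-- The adjunction identifies `Hom(L K, Z)` with `Hom(K, R Z)`, which moves the test object to the
category of `K`. -/
lemma HomExact.map_of_adjunction {L : C ⥤ D} {R : D ⥤ C} [L.Additive] (adj : L ⊣ R)
    {K : CochainComplex C ℤ} {Z : D} (h : HomExact K (R.obj Z)) :
    HomExact ((L.mapHomologicalComplex (ComplexShape.up ℤ)).obj K) Z := by
  intro i j k hij hjk f hf
  let f' : L.obj (K.X j) ⟶ Z := f
  have hf' : L.map (K.d i j) ≫ f' = 0 := hf
  have := adj.right_adjoint_additive
  obtain ⟨g, hg⟩ := h i j k hij hjk (adj.homEquiv _ _ f') (by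
    rw [← adj.homEquiv_naturality_left, hf', adj.homEquiv_unit, R.map_zero, comp_zero])
  have hg' : L.map (K.d j k) ≫ (adj.homEquiv _ _).symm g = f' := by
    rw [← adj.homEquiv_naturality_left_symm, hg, Equiv.symm_apply_apply]
  exact ⟨_, hg'⟩

end HomExactness

section CommaCategory

variable {A : Type u₁} [Category.{v₁} A] [Abelian A] {B : Type u₂} [Category.{v₂} B] [Abelian B]
  {F : A ⥤ B} [F.Additive]

/-- Since `φ` splits, `X` is a direct sum of `F Y` and `Coker φ`. Condition (P2) treats the first
summand, and completeness of `K` the second, which is projective. -/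
lemma IsPerfect.homExact_right (hF : IsPerfect F) {K : CochainComplex B ℤ}
    (hK : IsCompleteResolution K) {M : LeftComma F} (hM : Projective M) : HomExact K M.right := by
  intro i j k hij hjk f hf
  obtain ⟨ρ, hρ⟩ := exists_retraction hM
  obtain ⟨σ, hσ⟩ := exists_coker_desc (M := M) (𝟙 M.right - ρ ≫ structureMap M) (by
    rw [Preadditive.comp_sub, reassoc_of% hρ, Category.comp_id, sub_self])
  obtain ⟨g₁, hg₁⟩ := hF.homExact K hK _ (projective_left hM) i j k hij hjk (f ≫ ρ) (by
    rw [reassoc_of% hf, zero_comp])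
  obtain ⟨g₂, hg₂⟩ := hK.homExact _ (projective_coker hM) i j k hij hjk (f ≫ cokerπ M) (by
    rw [reassoc_of% hf, zero_comp])
  refine ⟨g₁ ≫ structureMap M + g₂ ≫ σ, ?_⟩
  rw [Preadditive.comp_add, reassoc_of% hg₁, reassoc_of% hg₂, hσ, Preadditive.comp_sub,
    Category.comp_id]
  abel

variable [PreservesFiniteColimits F]

/-- The structure maps of `K` are monic, so the cokernels form the quotient of the complex of second
components, which is exact, by `F` of the complex of first components, which is exact by (P1). -/
lemma IsPerfect.coker_complete (hF : IsPerfect F)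
    {K : CochainComplex (LeftComma F) ℤ} (hK : IsCompleteResolution K) : IsCompleteResolution
      (((cokerFunctor F).mapHomologicalComplex (ComplexShape.up ℤ)).obj K) where
  projective n := projective_coker (hK.projective n)
  homExact P hP := HomExact.map_of_adjunction (cokerAdjunction F)
    (hK.homExact _ (projective_zeroLeft hP))
  acyclic := by
    have hm n := mono_structureMap (hK.projective n)
    have hl := acyclic_map (leftFunctor F) hK.acyclic
    have hr := acyclic_map (rightFunctor F) hK.acyclic
    have hFl := hF.exact _ (fun n => projective_left (hK.projective n)) hl
    have hdd (i j k : ℤ) : (K.d i j).right ≫ (K.d j k).right = 0 :=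
      congrArg CommaMorphism.right (K.d_comp_d i j k)
    refine acyclic_of_refinement fun i j k hij hjk T x hx => ?_
    let x' : T ⟶ (cokerFunctor F).obj (K.X j) := x
    have hx' : x' ≫ (cokerFunctor F).map (K.d j k) = 0 := hx
    obtain ⟨T₁, π₁, _, y, hy⟩ := surjective_up_to_refinements_of_epi (cokerπ (K.X j)) x'
    obtain ⟨z, hz⟩ : ∃ z : T₁ ⟶ F.obj (K.X k).left,
        z ≫ structureMap (K.X k) = y ≫ (K.d j k).right := by
      have hs := exact_structureMap_cokerπ (K.X k)
      have : Mono (ShortComplex.mk _ _ (structureMap_cokerπ (K.X k))).f := hm k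
      have h0 : (y ≫ (K.d j k).right) ≫ cokerπ (K.X k) = 0 := by
        rw [Category.assoc, ← cokerπ_naturality, ← reassoc_of% hy, hx', comp_zero]
      exact ⟨hs.lift _ h0, hs.lift_f _ h0⟩
    have hz' : z ≫ F.map (K.d k (k + 1)).left = 0 := by
      have := hm (k + 1)
      rw [← cancel_mono (structureMap (K.X (k + 1))), Category.assoc, structureMap_comm,
        reassoc_of% hz, hdd, comp_zero, zero_comp]
    obtain ⟨T₂, π₂, _, w, hw⟩ : ∃ (T₂ : B) (π₂ : T₂ ⟶ T₁) (_ : Epi π₂)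
        (w : T₂ ⟶ F.obj (K.X j).left), π₂ ≫ z = w ≫ F.map (K.d j k).left :=
      exists_refinement hFl j k (k + 1) hjk rfl z hz'
    -- Subtracting the image of `w` turns the representative `y` into a genuine cycle without
    -- changing its class in the cokernel.
    obtain ⟨T₃, π₃, _, v, hv⟩ : ∃ (T₃ : B) (π₃ : T₃ ⟶ T₂) (_ : Epi π₃)
        (v : T₃ ⟶ (K.X i).right),
        π₃ ≫ (π₂ ≫ y - w ≫ structureMap (K.X j)) = v ≫ (K.d i j).right :=
      exists_refinement hr i j k hij hjk _ (by
        change (π₂ ≫ y - w ≫ structureMap (K.X j)) ≫ (K.d j k).right = 0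
        rw [Preadditive.sub_comp, Category.assoc, Category.assoc, ← structureMap_comm, ← hz,
          reassoc_of% hw, sub_self])
    have hfin : (π₃ ≫ π₂ ≫ π₁) ≫ x' =
        (v ≫ cokerπ (K.X i)) ≫ (cokerFunctor F).map (K.d i j) := by
      rw [Category.assoc v, cokerπ_naturality, ← reassoc_of% hv, Category.assoc, Category.assoc, hy,
        Preadditive.sub_comp, Category.assoc, Category.assoc, structureMap_cokerπ, comp_zero,
        sub_zero]
    exact ⟨T₃, π₃ ≫ π₂ ≫ π₁, inferInstance, v ≫ cokerπ (K.X i), hfin⟩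

/-- A cocycle with values in a projective `Q` is extended to a cocycle with values in the projective
object `(Q, F Q)`, to which Hom-exactness of `K` applies. The second component needs a correction,
provided by (P2) for the cokernel complex. -/
lemma IsPerfect.left_complete (hF : IsPerfect F)
    {K : CochainComplex (LeftComma F) ℤ} (hK : IsCompleteResolution K) : IsCompleteResolution
      (((leftFunctor F).mapHomologicalComplex (ComplexShape.up ℤ)).obj K) where
  projective n := projective_left (hK.projective n)
  acyclic := acyclic_map _ hK.acyclic
  homExact Q hQ i j k hij hjk f hf := by
    let f₁ : (K.X j).left ⟶ Q := f
    have hf₁ : (K.d i j).left ≫ f₁ = 0 := hf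
    obtain ⟨ρ, hρ⟩ := exists_retraction (hK.projective j)
    -- The first candidate `ρ ≫ F.map f₁` need not be a cocycle; its coboundary vanishes on `F Y`
    -- and so defines `c` on the cokernel.
    obtain ⟨c, hc⟩ := exists_coker_desc (M := K.X i) ((K.d i j).right ≫ ρ ≫ F.map f₁) (by
      rw [← Category.assoc, ← structureMap_comm, Category.assoc, reassoc_of% hρ, ← F.map_comp,
        hf₁, F.map_zero])
    have hc₀ : (cokerFunctor F).map (K.d (i - 1) i) ≫ c = 0 := by
      have hdd : (K.d (i - 1) i).right ≫ (K.d i j).right = 0 :=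
        congrArg CommaMorphism.right (K.d_comp_d _ i j)
      rw [← cancel_epi (cokerπ (K.X (i - 1))), ← Category.assoc, cokerπ_naturality,
        Category.assoc, hc, reassoc_of% hdd, zero_comp, comp_zero]
    obtain ⟨c', hc'⟩ : ∃ c' : (cokerFunctor F).obj (K.X j) ⟶ F.obj Q,
        (cokerFunctor F).map (K.d i j) ≫ c' = c :=
      hF.homExact _ (hF.coker_complete hK) Q hQ (i - 1) i j (by lia) hij c hc₀
    let b : (K.X j).right ⟶ F.obj Q := ρ ≫ F.map f₁ - cokerπ (K.X j) ≫ c'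
    have hb : structureMap (K.X j) ≫ b = F.map f₁ := by
      rw [Preadditive.comp_sub, reassoc_of% hρ, ← Category.assoc, structureMap_cokerπ, zero_comp,
        sub_zero]
    have hb₀ : (K.d i j).right ≫ b = 0 := by
      rw [Preadditive.comp_sub, ← hc, ← Category.assoc _ (cokerπ _), ← cokerπ_naturality,
        Category.assoc, hc', sub_self]
    obtain ⟨g, hg⟩ := hK.homExact _ (projective_free hQ) i j k hij hjk
      (commaHom (N := (freeFunctor F).obj Q) f₁ b ((Category.comp_id _).trans hb.symm)) (by
        ext
        · exact hf₁
        · exact hb₀)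
    exact ⟨g.left, congrArg CommaMorphism.left hg⟩

/-- `Hom((0, K), M)` is `Hom(K, M.right)`; this is where the second components of projective
objects, not projective in general, have to be controlled by (P2). -/
lemma IsPerfect.zeroLeft_complete (hF : IsPerfect F) {K : CochainComplex B ℤ}
    (hK : IsCompleteResolution K) : IsCompleteResolution
      (((zeroLeft F).mapHomologicalComplex (ComplexShape.up ℤ)).obj K) where
  projective n := projective_zeroLeft (hK.projective n)
  acyclic := comma_acyclic
    (fun n => ShortComplex.exact_of_isZero_X₂ _ (isZero_zeroLeft_left F (K.X n))) hK.acyclic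
  homExact _ hM := HomExact.map_of_adjunction (zeroLeftAdjunction F) (hF.homExact_right hK hM)

lemma IsPerfect.free_complete (hF : IsPerfect F) {K : CochainComplex A ℤ}
    (hK : IsCompleteResolution K) : IsCompleteResolution
      (((freeFunctor F).mapHomologicalComplex (ComplexShape.up ℤ)).obj K) where
  projective n := projective_free (hK.projective n)
  acyclic := comma_acyclic hK.acyclic (hF.exact K hK.projective hK.acyclic)
  homExact _ hM := HomExact.map_of_adjunction (freeAdjunction F)
    (hK.homExact _ (projective_left hM))

lemma IsPerfect.coker_preserves (hF : IsPerfect F) :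
    PreservesCompleteResolutions (cokerFunctor F) :=
  ⟨fun _ => projective_coker, fun _ => hF.coker_complete⟩

lemma IsPerfect.zeroLeft_preserves (hF : IsPerfect F) :
    PreservesCompleteResolutions (zeroLeft F) :=
  ⟨fun _ => projective_zeroLeft, fun _ => hF.zeroLeft_complete⟩

lemma IsPerfect.free_preserves (hF : IsPerfect F) :
    PreservesCompleteResolutions (freeFunctor F) :=
  ⟨fun _ => projective_free, fun _ => hF.free_complete⟩

lemma IsPerfect.left_preserves (hF : IsPerfect F) :
    PreservesCompleteResolutions (leftFunctor F) :=
  ⟨fun _ => projective_left, fun _ => hF.left_complete⟩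

/-! ### The canonical short exact sequence -/

/-- An embedding of `M` into a projective object is part of a complete resolution. Its first
component stays monic under `F`, and the structure map of the projective object is monic; by
commutativity their composite begins with the structure map of `M`. -/
lemma IsPerfect.mono_structureMap (hF : IsPerfect F) {M : LeftComma F}
    (hM : GProj (LeftComma F) M) : Mono (structureMap M) := by
  obtain ⟨r⟩ := Resolution.exists_of_gproj hM
  have h₁ : Mono ((freeFunctor F).map r.i.left) :=
    hF.free_preserves.mono_map_i (hF.left_preserves.mapResolution r)
  have h₂ : Mono (F.map r.i.left) :=
    inferInstanceAs (Mono ((rightFunctor F).map ((freeFunctor F).map r.i.left)))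
  have h₃ := GorensteinComma.mono_structureMap (r.complete.projective 0)
  have h₄ := mono_comp (F.map r.i.left) (structureMap (r.K.X 0))
  rw [structureMap_comm] at h₄
  exact mono_of_mono _ r.i.right

/-- The first components are `Y = Y ⟶ 0`, and the second ones `F Y ⟶ X ⟶ Coker φ`; only injectivity
of `φ` uses that `M` is Gorenstein projective. -/
lemma IsPerfect.exists_shortExact (hF : IsPerfect F) {M : LeftComma F}
    (hM : GProj (LeftComma F) M) : ∃ h : freeCounit M ≫ cokerUnit M = 0,
      (ShortComplex.mk (freeCounit M) (cokerUnit M) h).ShortExact := by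
  have h : freeCounit M ≫ cokerUnit M = 0 := by
    ext
    · exact (isZero_zeroLeft_left F _).eq_of_tgt _ _
    · exact structureMap_cokerπ M
  have : Mono (freeCounit M).left := inferInstanceAs (Mono (𝟙 M.left))
  have : Mono (freeCounit M).right := hF.mono_structureMap hM
  have : Epi (cokerUnit M).left := ⟨fun _ _ _ => (isZero_zeroLeft_left F _).eq_of_src _ _⟩
  have : Epi (cokerUnit M).right := inferInstanceAs (Epi (cokerπ M))
  have hm := comma_mono_of_mono (freeCounit M)
  have he := comma_epi_of_epi (cokerUnit M)
  refine ⟨h, ?_⟩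
  have hex : (ShortComplex.mk (freeCounit M) (cokerUnit M) h).Exact := by
    refine comma_exact ?_ (exact_structureMap_cokerπ M)
    refine (ShortComplex.exact_iff_epi _
      ((isZero_zeroLeft_left F ((cokerFunctor F).obj M)).eq_of_tgt _ _)).2 ?_
    exact inferInstanceAs (Epi (𝟙 M.left))
  exact { exact := hex, mono_f := hm, epi_g := he }

/-! ### The left recollement -/

attribute [local instance] stableShift stableShift_additive stablePretriangulated
  stable_isTriangulated

/-- The adjunction between `i^*` and `i_*` on stable categories. -/
abbrev IsPerfect.cokerStableAdjunction (hF : IsPerfect F) :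
    stableMap (cokerFunctor F) hF.coker_preserves.preservesGP ⊣
      stableMap (zeroLeft F) hF.zeroLeft_preserves.preservesGP :=
  stableAdjunction (cokerAdjunction F) _ _

/-- The adjunction between `j_!` and `j^*` on stable categories. -/
abbrev IsPerfect.freeStableAdjunction (hF : IsPerfect F) :
    stableMap (freeFunctor F) hF.free_preserves.preservesGP ⊣
      stableMap (leftFunctor F) hF.left_preserves.preservesGP :=
  stableAdjunction (freeAdjunction F) _ _

lemma IsPerfect.exists_distinguished (hF : IsPerfect F) (M : StableGP (LeftComma F)) :
    ∃ h, Triangle.mk (hF.freeStableAdjunction.counit.app M)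
      (hF.cokerStableAdjunction.unit.app M) h ∈ distTriang (StableGP (LeftComma F)) := by
  obtain ⟨zero, hS⟩ := hF.exists_shortExact M.as.property
  exact exists_distinguished_of_shortExact
    (X := ⟨_, hF.free_preserves.preservesGP.gproj _
      (hF.left_preserves.preservesGP.gproj _ M.as.property)⟩) (Y := M.as)
    (Z := ⟨_, hF.zeroLeft_preserves.preservesGP.gproj _
      (hF.coker_preserves.preservesGP.gproj _ M.as.property)⟩)
    (ObjectProperty.homMk (freeCounit M.as.obj)) (ObjectProperty.homMk (cokerUnit M.as.obj)) zero hS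

/-- The left recollement of the stable categories induced by a perfect functor. -/
def IsPerfect.leftRecollement (hF : IsPerfect F) : LeftRecollement
    (stableMap (cokerFunctor F) hF.coker_preserves.preservesGP)
    (stableMap (zeroLeft F) hF.zeroLeft_preserves.preservesGP)
    (stableMap (freeFunctor F) hF.free_preserves.preservesGP)
    (stableMap (leftFunctor F) hF.left_preserves.preservesGP) where
  iUp_commShift := hF.coker_preserves.stableMapCommShift
  iUp_exact := hF.coker_preserves.stableMap_isTriangulated
  iLow_commShift := hF.zeroLeft_preserves.stableMapCommShift
  iLow_exact := hF.zeroLeft_preserves.stableMap_isTriangulated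
  jShriek_commShift := hF.free_preserves.stableMapCommShift
  jShriek_exact := hF.free_preserves.stableMap_isTriangulated
  jUp_commShift := hF.left_preserves.stableMapCommShift
  jUp_exact := hF.left_preserves.stableMap_isTriangulated
  adj_i := hF.cokerStableAdjunction
  adj_j := hF.freeStableAdjunction
  iLow_full := hF.cokerStableAdjunction.fullyFaithfulROfIsIsoCounit.full
  iLow_faithful := hF.cokerStableAdjunction.fullyFaithfulROfIsIsoCounit.faithful
  jShriek_full := hF.freeStableAdjunction.fullyFaithfulLOfIsIsoUnit.full
  jShriek_faithful := hF.freeStableAdjunction.fullyFaithfulLOfIsIsoUnit.faithful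
  comp_zero X := by
    let Z : GP A := ⟨((zeroLeft F).obj X.as.obj).left, hF.left_preserves.preservesGP.gproj _
      (hF.zeroLeft_preserves.preservesGP.gproj _ X.as.property)⟩
    have hZ : IsZero Z := by
      rw [IsZero.iff_id_eq_zero]
      ext
      exact (isZero_zeroLeft_left F X.as.obj).eq_of_src _ _
    exact (toStable A).map_isZero hZ
  triangle M := hF.exists_distinguished M

end CommaCategory

end GorensteinComma

end

theorem theorem4p4 {A : Type u₁} [Category.{v₁} A] [Abelian A]
    {B : Type u₂} [Category.{v₂} B] [Abelian B]
    (F : A ⥤ B) [F.Additive] [PreservesFiniteColimits F] (hF : IsPerfect F) :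
    ∃ (_ : StableTriangulation A) (_ : StableTriangulation B)
      (_ : StableTriangulation (LeftComma F))
      (h₁ : PreservesGP (cokerFunctor F)) (h₂ : PreservesGP (zeroLeft F))
      (h₃ : PreservesGP (freeFunctor F)) (h₄ : PreservesGP (leftFunctor F)),
      Nonempty (LeftRecollement
        (stableMap (cokerFunctor F) h₁) (stableMap (zeroLeft F) h₂)
        (stableMap (freeFunctor F) h₃) (stableMap (leftFunctor F) h₄)) := by
  exact ⟨stableTriangulation A, stableTriangulation B, stableTriangulation (LeftComma F),
    hF.coker_preserves.preservesGP, hF.zeroLeft_preserves.preservesGP,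
    hF.free_preserves.preservesGP, hF.left_preserves.preservesGP, ⟨hF.leftRecollement⟩⟩
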